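/- Let $K$ be a field of characteristic $0$ and let $\mathfrak g$ be a finite-dimensional semisimple Lie algebra over $K$ with a splitting Cartan subalgebra $\mathfrak h$ (if $K=\mathbb C$, every Cartan subalgebra is splitting). Let $\mathfrak b$ be a Borel subalgebra containing $\mathfrak h$, that is, $\mathfrak b=\mathfrak h\oplus\bigoplus_{\alpha>0}\mathfrak g^\alpha$ for some choice of a base of the root system, and let $\mathfrak p\supseteq\mathfrak b$ be a (parabolic) subalgebra. Let $\mathfrak n$ be the nilradical of $\mathfrak p$ (its largest nilpotent ideal), let $\mathfrak n_-$ be the subalgebra generated by the root spaces $\mathfrak g^{-\alpha}$ for the roots $\alpha$ with $\mathfrak g^{\alpha}\subseteq\mathfrak n$, and let $u_1,\dots,u_n$ be a basis of $\mathfrak n_-$ consisting of root vectors (for instance, elements of a Chevalley-Weyl basis), in any order. Let $M_0(\mathfrak g,\mathfrak p)=U(\mathfrak g)\otimes_{U(\mathfrak p)}K$ be the generalized Verma module induced from the one-dimensional trivial representation $K$ of $\mathfrak p$, with $m_1=1\in K$. Let $\mathbb W_n$ be the Weyl algebra over $K$, i.e. the associative unital $K$-algebra generated by $x_1,\dots,x_n,\partial_1,\dots,\partial_n$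 with relations $x_ix_j=x_jx_i$, $\partial_i\partial_j=\partial_j\partial_i$, $\partial_jx_i-x_i\partial_j=\delta_{ij}$, acting on $\mathbb S_n=K[x_1,\dots,x_n]$ by polynomial differential operators. Then there is a $K$-linear isomorphism $\varphi_0:M_0(\mathfrak g,\mathfrak p)\to\mathbb S_n$ with $$\varphi_0\bigl(u_1^{a_1}\cdots u_n^{a_n}\otimes_{U(\mathfrak p)} m_1\bigr)=x_1^{a_1}\cdots x_n^{a_n}\qquad\text{for all } a_1,\dots,a_n\ge 0,$$ and for it the following hold. (a) There exists a linear map $\Phi_0:U(\mathfrak g)\to\mathbb W_n$ such that, for all $a\in U(\mathfrak g)$ and $s\in\mathbb S_n$, $\;\varphi_0\bigl(a\cdot\varphi_0^{-1}(s)\bigr)=\Phi_0(a)\cdot s$. (b) Every linear map $\Phi_0$ as in (a) is a homomorphism of Lie algebras for the commutator brackets: $\Phi_0(ac-ca)=\Phi_0(a)\Phi_0(c)-\Phi_0(c)\Phi_0(a)$ for all $a,c\in U(\mathfrak g)$. -/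

import Mathlib

open scoped TensorProduct

noncomputable section

/-! ### The Weyl algebra and its action on polynomials -/

/-- The defining relations of the Weyl algebra in `n` variables. The free generator `Sum.inl i`
stands for `x_i`, the free generator `Sum.inr i` for `∂_i`. -/
inductive WeylAlgebra.Rel (K : Type*) [CommRing K] (n : ℕ) :
    FreeAlgebra K (Fin n ⊕ Fin n) → FreeAlgebra K (Fin n ⊕ Fin n) → Prop
  | x_comm (i j : Fin n) : WeylAlgebra.Rel K n
      (FreeAlgebra.ι K (Sum.inl i) * FreeAlgebra.ι K (Sum.inl j))
      (FreeAlgebra.ι K (Sum.inl j) * FreeAlgebra.ι K (Sum.inl i))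
  | d_comm (i j : Fin n) : WeylAlgebra.Rel K n
      (FreeAlgebra.ι K (Sum.inr i) * FreeAlgebra.ι K (Sum.inr j))
      (FreeAlgebra.ι K (Sum.inr j) * FreeAlgebra.ι K (Sum.inr i))
  | d_x (i j : Fin n) : WeylAlgebra.Rel K n
      (FreeAlgebra.ι K (Sum.inr j) * FreeAlgebra.ι K (Sum.inl i)
        - FreeAlgebra.ι K (Sum.inl i) * FreeAlgebra.ι K (Sum.inr j))
      (if i = j then 1 else 0)

/-- The Weyl algebra `𝕎_n` over `K`: the associative unital `K`-algebra generated by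
`x_1, …, x_n, ∂_1, …, ∂_n` subject to `x_i x_j = x_j x_i`, `∂_i ∂_j = ∂_j ∂_i` and
`∂_j x_i - x_i ∂_j = δ_ij`. -/
abbrev WeylAlgebra (K : Type*) [CommRing K] (n : ℕ) : Type _ :=
  RingQuot (WeylAlgebra.Rel K n)

namespace WeylAlgebra

variable (K : Type*) [CommRing K] (n : ℕ)

/-- The operator on polynomials attached to a free generator: multiplication by `x_i`, respectively
the partial derivative `∂/∂x_i`. -/
def genAction : Fin n ⊕ Fin n → Module.End K (MvPolynomial (Fin n) K)
  | Sum.inl i => LinearMap.mulLeft K (MvPolynomial.X i)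
  | Sum.inr i => (MvPolynomial.pderiv i).toLinearMap

theorem genAction_rel ⦃a b : FreeAlgebra K (Fin n ⊕ Fin n)⦄ (h : Rel K n a b) :
    FreeAlgebra.lift K (genAction K n) a = FreeAlgebra.lift K (genAction K n) b := by
  cases h with
  | x_comm i j =>
    refine LinearMap.ext fun p => ?_
    simp [genAction, mul_left_comm]
  | d_comm i j =>
    simp only [map_mul, FreeAlgebra.lift_ι_apply, genAction]
    have h0 : ⁅MvPolynomial.pderiv (R := K) i, MvPolynomial.pderiv (R := K) j⁆ = 0 := by
      apply MvPolynomial.derivation_ext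
      intro k
      simp only [Derivation.commutator_apply, MvPolynomial.pderiv_X, Derivation.coe_zero,
        Pi.zero_apply]
      simp only [Pi.single_apply, apply_ite, map_zero, Derivation.map_one_eq_zero,
        ite_self, sub_self]
    refine LinearMap.ext fun p => ?_
    have h1 := DFunLike.congr_fun h0 p
    rw [Derivation.commutator_apply, Derivation.coe_zero, Pi.zero_apply, sub_eq_zero] at h1
    exact h1
  | d_x i j =>
    refine LinearMap.ext fun p => ?_
    by_cases hij : i = j
    · subst hij
      simp [genAction, Derivation.leibniz]
    · simp [genAction, Derivation.leibniz, hij, MvPolynomial.pderiv_X_of_ne hij]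

/-- The action of the Weyl algebra on `𝕊_n = K[x_1, …, x_n]` by polynomial differential
operators. -/
def action : WeylAlgebra K n →ₐ[K] Module.End K (MvPolynomial (Fin n) K) :=
  RingQuot.liftAlgHom K ⟨FreeAlgebra.lift K (genAction K n), genAction_rel K n⟩

end WeylAlgebra

/-! ### Borel subalgebras and the nilradical of a parabolic subalgebra -/

section Subalgebras

variable {K g : Type*} [Field K] [LieRing g] [LieAlgebra K g]

/-- `b` is a Borel subalgebra containing the splitting Cartan subalgebra `H`: the sum of `H` and of
the root spaces of the roots that are positive with respect to some base of the root system. -/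
def IsBorelSubalgebra [CharZero K] [FiniteDimensional K g] [LieAlgebra.IsSemisimple K g]
    (H : LieSubalgebra K g) [H.IsCartanSubalgebra] [LieModule.IsTriangularizable K H g]
    (b : LieSubalgebra K g) : Prop :=
  ∃ Δ : (LieAlgebra.IsKilling.rootSystem H).Base,
    b.toSubmodule = H.toSubmodule ⊔
      ⨆ α : H.root, ⨆ _ : Δ.IsPos α, (LieAlgebra.rootSpace H (α : LieModule.Weight K H g)).toSubmodule

/-- The nilradical of `p`, as a subspace of the ambient Lie algebra: the largest nilpotent ideal of
`p`, that is, the sum of all ideals of `p` that are nilpotent as Lie algebras. -/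
def nilradicalIn (p : LieSubalgebra K g) : Submodule K g :=
  (sSup {I : LieIdeal K p | LieRing.IsNilpotent I} : LieIdeal K p).toSubmodule.map
    p.toSubmodule.subtype

/-- The subalgebra `n₋` opposite to the nilradical `n` of `p`: it is generated by the root spaces
`g^(-α)`, where `α` runs over the roots with `g^α ⊆ n`. -/
def oppositeNilradical (H : LieSubalgebra K g) [LieRing.IsNilpotent H] [FiniteDimensional K g]
    (p : LieSubalgebra K g) : LieSubalgebra K g :=
  LieSubalgebra.lieSpan K g
    {x | ∃ α : LieModule.Weight K H g, α.IsNonZero ∧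
      (LieAlgebra.rootSpace H α).toSubmodule ≤ nilradicalIn p ∧
      x ∈ LieAlgebra.rootSpace H (-(α : H → K))}

end Subalgebras

/-! ### Induced modules -/

section Induced

variable {K g : Type*} [Field K] [LieRing g] [LieAlgebra K g] (p : LieSubalgebra K g)

section

attribute [local instance] LieRing.ofAssociativeRing

/-- The map `U(p) → U(g)` induced by the inclusion of a subalgebra. -/
def uMap : UniversalEnvelopingAlgebra K p →ₐ[K] UniversalEnvelopingAlgebra K g :=
  UniversalEnvelopingAlgebra.lift K ((UniversalEnvelopingAlgebra.ι K).comp p.incl)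

end

variable (V : Type*) [AddCommGroup V] [Module K V] [LieRingModule p V] [LieModule K p V]

/-- The `U(g)`-submodule of `U(g) ⊗_K V` generated by the elements `a c ⊗ v - a ⊗ c v` with
`a ∈ U(g)`, `c ∈ U(p)` and `v ∈ V`. -/
def inducedRel : Submodule (UniversalEnvelopingAlgebra K g) (UniversalEnvelopingAlgebra K g ⊗[K] V) :=
  Submodule.span _ {z | ∃ (a : UniversalEnvelopingAlgebra K g) (c : UniversalEnvelopingAlgebra K p)
    (v : V), z = (a * uMap p c) ⊗ₜ[K] v
      - a ⊗ₜ[K] (UniversalEnvelopingAlgebra.lift K (LieModule.toEnd K p V) c v)}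

/-- The induced `U(g)`-module `U(g) ⊗_{U(p)} V`. -/
abbrev InducedModule : Type _ := (UniversalEnvelopingAlgebra K g ⊗[K] V) ⧸ inducedRel p V

/-- The element `a ⊗_{U(p)} v` of `U(g) ⊗_{U(p)} V`. -/
def inducedTmul (a : UniversalEnvelopingAlgebra K g) (v : V) : InducedModule p V :=
  (inducedRel p V).mkQ (a ⊗ₜ[K] v)

/-- The generalized Verma module `M_0(g, p)`, induced from the one-dimensional trivial
representation of `p`. -/
abbrev GenVerma₀ : Type _ := InducedModule p (TrivialLieModule K p K)

/-- The element `a ⊗_{U(p)} m_1` of `M_0(g, p)`, where `m_1 = 1` is the basis vector of the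
trivial representation. -/
def genVermaTmul (a : UniversalEnvelopingAlgebra K g) : GenVerma₀ p :=
  inducedTmul p (TrivialLieModule K p K) a ((TrivialLieModule.equiv K p K).symm 1)

end Induced

/-- The ordered monomial `u_1^{a_1} ⋯ u_n^{a_n}` in `U(g)`. -/
def pbwMonomial {K g : Type*} [Field K] [LieRing g] [LieAlgebra K g] {n : ℕ} (u : Fin n → g)
    (a : Fin n →₀ ℕ) : UniversalEnvelopingAlgebra K g :=
  (List.ofFn fun i => UniversalEnvelopingAlgebra.ι K (u i) ^ a i).prod

/-- Commutativity of the diagram: for every `a ∈ U(g)`, the operator `φ ∘ a ∘ φ⁻¹` on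
`𝕊_n` is the action of the differential operator `Φ a`. -/
def DiagramCommutes {K g : Type*} [Field K] [LieRing g] [LieAlgebra K g] {p : LieSubalgebra K g}
    {n : ℕ} (φ : GenVerma₀ p ≃ₗ[K] MvPolynomial (Fin n) K)
    (Φ : UniversalEnvelopingAlgebra K g →ₗ[K] WeylAlgebra K n) : Prop :=
  ∀ a : UniversalEnvelopingAlgebra K g,
    φ.conj (Algebra.lsmul K K (GenVerma₀ p) a) = WeylAlgebra.action K n (Φ a)

end

/-! Two things are needed: a PBW basis of the induced module, and an argument that the action of
`U(g)`, written in that basis, is by differential operators with finitely many terms.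

Basis. A base of the root system gives an additive height on weights for which `p` contains `H` and
every root space of non-negative height. Then `g^α` lies in the nilradical exactly when `g^(-α)` is
not contained in `p`, so `n₋` is the sum of the root spaces outside `p` and is a complement of `p`
(`oppositeNilradical_eq`, `isCompl_weightSup`). PBW for `g = n₋ ⊕ p` makes `U(g)` free over `U(p)`
on the monomials `u^a`, which yields `φ` (`exists_genVerma_equiv`). Linear independence in PBW comes
from the faithful adjoint representation: contracting a coaction of `U(g)` with suitable linear
forms imitates partial differentiation on leading terms.

Differential operators. Let `T_i(y)` send `x^a` to the image of `u^a ⊗ m_1` with `y` inserted before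
the factor `u_i^(a_i)`. Moving `y` across that factor gives `T_i(y) = ∑_k (1/k!) T_(i+1)((-ad u_i)^k
y) ∂_i^k`, because the coefficient `choose (a_i) k` together with the drop of the exponent by `k` is
`∂_i^k / k!`. The sum is finite since `ad u_i` is nilpotent. Hence `T_0(y)`, the left action of `y`,
reduces to operators `T_n(z)`. Elements `z` of `p` contribute zero. For `z = u_j` the same formula,
used in both directions, leads to `T_j(u_j)`, which is multiplication by `x_j`; the error terms
involve iterated brackets, which lie deeper in `n₋`, and induction on depth disposes of them.

Existence of `Φ` then follows by inverting the action of the Weyl algebra on its image. That action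
is faithful in characteristic zero, so any `Φ` inherits compatibility with commutators from the
operators. -/

noncomputable section

open scoped TensorProduct

/-! ### PBW for Lie algebras with a suitable representation -/

namespace UniversalEnvelopingAlgebra

attribute [local instance] LieRing.ofAssociativeRing

variable {K L ι : Type*} [Field K] [LieRing L] [LieAlgebra K L]

/-- The product in `U(L)` of a list of elements of `L`. -/
def listProd (l : List L) : UniversalEnvelopingAlgebra K L := (l.map (UniversalEnvelopingAlgebra.ι K)).prod

variable (K) in
@[simp] theorem listProd_nil : listProd (K := K) ([] : List L) = 1 := rfl

@[simp] theorem listProd_cons (x : L) (l : List L) :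
    listProd (K := K) (x :: l) = UniversalEnvelopingAlgebra.ι K x * listProd l := by
  simp [listProd]

theorem listProd_append (l l' : List L) :
    listProd (K := K) (l ++ l') = listProd l * listProd l' := by
  simp [listProd]

variable (K L) in
/-- The span of the products of fewer than `d` elements of `L`. -/
def low (d : ℕ) : Submodule K (UniversalEnvelopingAlgebra K L) :=
  Submodule.span K {w | ∃ l : List L, l.length < d ∧ listProd l = w}

theorem listProd_mem_low {l : List L} {d : ℕ} (h : l.length < d) : listProd l ∈ low K L d :=
  Submodule.subset_span ⟨l, h, rfl⟩

theorem low_mono {d d' : ℕ} (h : d ≤ d') : low K L d ≤ low K L d' :=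
  Submodule.span_mono fun _ ⟨l, hl, hw⟩ => ⟨l, hl.trans_le h, hw⟩

theorem ι_mul_mem_low (x : L) {d : ℕ} {w : UniversalEnvelopingAlgebra K L} (hw : w ∈ low K L d) :
    UniversalEnvelopingAlgebra.ι K x * w ∈ low K L (d + 1) := by
  induction hw using Submodule.span_induction with
  | mem w h =>
    obtain ⟨l, hl, rfl⟩ := h
    rw [← listProd_cons]
    exact listProd_mem_low (by simpa using hl)
  | zero => simp
  | add a b _ _ ha hb => rw [mul_add]; exact add_mem ha hb
  | smul c a _ ha => rw [mul_smul_comm]; exact Submodule.smul_mem _ _ ha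

/-- Swapping two adjacent factors costs `yx - xy = [y, x]`, a product with one factor fewer. -/
theorem listProd_sub_mem_low_of_perm {l l' : List L} (h : l.Perm l') :
    listProd (K := K) l - listProd l' ∈ low K L l.length := by
  induction h with
  | nil => simp
  | cons x _ ih =>
    rw [listProd_cons, listProd_cons, ← mul_sub, List.length_cons]
    exact ι_mul_mem_low x ih
  | swap x y l =>
    have : listProd (K := K) (y :: x :: l) - listProd (x :: y :: l) = listProd (⁅y, x⁆ :: l) := by
      simp only [listProd_cons, LieHom.map_lie, LieRing.of_associative_ring_bracket]
      noncomm_ring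
    rw [this]
    exact listProd_mem_low (by simp)
  | trans h1 h2 ih1 ih2 =>
    rw [← sub_add_sub_cancel]
    exact add_mem ih1 (by rw [h1.length_eq]; exact ih2)

/-- The elements whose left multiplication preserves `S` form a subalgebra containing the image of
`L`; by the universal property the identity of `U(L)` factors through it, so it is everything. -/
theorem adjoin_induction_left {p : UniversalEnvelopingAlgebra K L → Prop} (one : p 1)
    (mul : ∀ x w, p w → p (UniversalEnvelopingAlgebra.ι K x * w))
    (add : ∀ a b, p a → p b → p (a + b)) (smul : ∀ (c : K) a, p a → p (c • a))
    (w : UniversalEnvelopingAlgebra K L) : p w := by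
  let S : Submodule K (UniversalEnvelopingAlgebra K L) :=
    { carrier := {w | p w}
      add_mem' := fun {a b} ha hb => add a b ha hb
      zero_mem' := by simpa using smul 0 1 one
      smul_mem' := fun c a ha => smul c a ha }
  let A : Subalgebra K (UniversalEnvelopingAlgebra K L) :=
    { carrier := {a | ∀ w ∈ S, a * w ∈ S}
      mul_mem' := fun {a b} ha hb w hw => by rw [mul_assoc]; exact ha _ (hb _ hw)
      add_mem' := fun {a b} ha hb w hw => by rw [add_mul]; exact S.add_mem (ha _ hw) (hb _ hw)
      algebraMap_mem' := fun r w hw => by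
        rw [← Algebra.smul_def]; exact S.smul_mem _ hw }
  let f : L →ₗ⁅K⁆ A :=
    { toFun := fun x => ⟨UniversalEnvelopingAlgebra.ι K x, fun w hw => mul x w hw⟩
      map_add' := fun x y => by ext; simp
      map_smul' := fun x y => by ext; simp
      map_lie' := fun {x y} => by
        ext
        simp [LieRing.of_associative_ring_bracket] }
  have h : A.val.comp (lift K f) = AlgHom.id K _ := by
    ext x
    simp [f]
  have h1 : w ∈ A := by
    have := DFunLike.congr_fun h w
    rw [AlgHom.comp_apply, AlgHom.id_apply] at this
    rw [← this]
    exact (lift K f w).2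
  have h2 : w * 1 ∈ S := h1 1 one
  rwa [mul_one] at h2

theorem exists_mem_low (w : UniversalEnvelopingAlgebra K L) : ∃ d, w ∈ low K L d := by
  induction w using adjoin_induction_left with
  | one => exact ⟨1, listProd_mem_low (l := []) (by simp)⟩
  | mul x w h =>
    obtain ⟨d, h⟩ := h
    exact ⟨d + 1, ι_mul_mem_low x h⟩
  | add a b ha hb =>
    obtain ⟨d, ha⟩ := ha
    obtain ⟨d', hb⟩ := hb
    exact ⟨max d d', add_mem (low_mono (le_max_left _ _) ha) (low_mono (le_max_right _ _) hb)⟩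
  | smul c a ha =>
    obtain ⟨d, ha⟩ := ha
    exact ⟨d, Submodule.smul_mem _ _ ha⟩

theorem listProd_mem_span {e : ι → L} (he : Submodule.span K (Set.range e) = ⊤) (l : List L) :
    listProd l ∈ Submodule.span K
      {w : UniversalEnvelopingAlgebra K L | ∃ l' : List ι, l'.length = l.length ∧ listProd (l'.map e) = w} := by
  induction l with
  | nil => exact Submodule.subset_span ⟨[], rfl, rfl⟩
  | cons x l ih =>
    rw [listProd_cons]
    have hx : x ∈ Submodule.span K (Set.range e) := he ▸ Submodule.mem_top
    induction hx using Submodule.span_induction with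
    | mem x h =>
      obtain ⟨i, rfl⟩ := h
      generalize listProd (K := K) l = v at ih
      induction ih using Submodule.span_induction with
      | mem w h =>
        obtain ⟨l', hl, rfl⟩ := h
        exact Submodule.subset_span ⟨i :: l', by simpa using hl, by simp⟩
      | zero => simp
      | add a b _ _ ha hb => rw [mul_add]; exact add_mem ha hb
      | smul c a _ ha => rw [mul_smul_comm]; exact Submodule.smul_mem _ _ ha
    | zero => simp
    | add a b _ _ ha hb => rw [map_add, add_mul]; exact add_mem ha hb
    | smul c a _ ha => rw [map_smul, smul_mul_assoc]; exact Submodule.smul_mem _ _ ha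

/-- If every list of indices is a rearrangement of one of the lists `s j`, then the corresponding
monomials span `U(L)`. -/
theorem span_listProd_eq_top {J : Type*} {e : ι → L} (he : Submodule.span K (Set.range e) = ⊤)
    {s : J → List ι} (hs : ∀ l, ∃ j, (s j).Perm l) :
    Submodule.span K (Set.range fun j => listProd (K := K) ((s j).map e)) = ⊤ := by
  -- Expand each factor in the spanning family and sort; sorting errors have lower degree and are
  -- covered by induction.
  have key (d : ℕ) : low K L d ≤ Submodule.span K (Set.range fun j => listProd ((s j).map e)) := by
    induction d with
    | zero => exact Submodule.span_le.mpr fun w ⟨l, hl, _⟩ => by simp at hl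
    | succ d ih =>
      refine Submodule.span_le.mpr ?_
      rintro w ⟨l, hl, rfl⟩
      refine Submodule.span_le.mpr ?_ (listProd_mem_span he l)
      rintro w ⟨l', hl', rfl⟩
      obtain ⟨j, hj⟩ := hs l'
      rw [SetLike.mem_coe, ← sub_add_cancel (listProd (l'.map e)) (listProd ((s j).map e))]
      refine add_mem (ih (low_mono ?_ (listProd_sub_mem_low_of_perm (hj.map e).symm)))
        (Submodule.subset_span ⟨j, rfl⟩)
      rw [List.length_map]
      omega
  rw [eq_top_iff]
  intro w _
  obtain ⟨d, hd⟩ := exists_mem_low w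
  exact key d hd

section Contraction

variable {A : Type*} [Ring A] [Algebra K A] (ρ : L →ₗ⁅K⁆ A)

/-- The homomorphism `U(L) → A ⊗ U(L)` extending `x ↦ ρ x ⊗ 1 + 1 ⊗ x`. -/
def coaction : UniversalEnvelopingAlgebra K L →ₐ[K] A ⊗[K] UniversalEnvelopingAlgebra K L :=
  lift K
    { toLinearMap := (TensorProduct.mk K A _).flip 1 ∘ₗ ρ.toLinearMap +
        TensorProduct.mk K A _ 1 ∘ₗ (UniversalEnvelopingAlgebra.ι K).toLinearMap
      map_lie' := fun {x y} => by
        simp [LieRing.of_associative_ring_bracket, TensorProduct.tmul_sub,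
          mul_add, add_mul]
        abel }

theorem coaction_ι (x : L) : coaction ρ (UniversalEnvelopingAlgebra.ι K x) =
    ρ x ⊗ₜ 1 + 1 ⊗ₜ UniversalEnvelopingAlgebra.ι K x := by
  rw [coaction, lift_ι_apply]
  rfl

/-- The contraction of the coaction of `A` with a linear form on `A`. -/
def contract (f : A →ₗ[K] K) :
    UniversalEnvelopingAlgebra K L →ₗ[K] UniversalEnvelopingAlgebra K L :=
  (TensorProduct.lid K _).toLinearMap ∘ₗ f.rTensor _ ∘ₗ (coaction ρ).toLinearMap

theorem contract_one (f : A →ₗ[K] K) : contract ρ f 1 = f 1 • 1 := by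
  simp [contract, Algebra.TensorProduct.one_def]

/-- A twisted Leibniz rule, the recursion behind all degree estimates below. -/
theorem contract_ι_mul (f : A →ₗ[K] K) (x : L) (w : UniversalEnvelopingAlgebra K L) :
    contract ρ f (UniversalEnvelopingAlgebra.ι K x * w) =
      contract ρ (f ∘ₗ LinearMap.mulLeft K (ρ x)) w +
        UniversalEnvelopingAlgebra.ι K x * contract ρ f w := by
  simp only [contract, LinearMap.comp_apply, AlgHom.toLinearMap_apply, map_mul, coaction_ι, add_mul,
    map_add]
  induction coaction ρ w using TensorProduct.induction_on with
  | zero => simp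
  | tmul a v => simp
  | add a b ha hb =>
    simp only [mul_add, map_add] at *
    rw [add_add_add_comm, ha, hb]
    abel

theorem contract_listProd (f : A →ₗ[K] K) (l : List L) :
    contract ρ f (listProd l) - f 1 • listProd l ∈ low K L l.length := by
  induction l generalizing f with
  | nil => simp [contract_one]
  | cons x l ih =>
    rw [listProd_cons, contract_ι_mul, ← mul_smul_comm, add_sub_assoc, ← mul_sub]
    refine add_mem ?_ (ι_mul_mem_low x (ih f))
    rw [← sub_add_cancel (contract ρ (f ∘ₗ LinearMap.mulLeft K (ρ x)) (listProd l))]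
    exact add_mem (low_mono (Nat.le_succ _) (ih _))
      (Submodule.smul_mem _ _ (listProd_mem_low (Nat.lt_succ_self _)))

theorem contract_mem_low {f : A →ₗ[K] K} (hf : f 1 = 0) {d : ℕ}
    {w : UniversalEnvelopingAlgebra K L} (hw : w ∈ low K L (d + 1)) :
    contract ρ f w ∈ low K L d := by
  refine Submodule.span_le (p := (low K L d).comap (contract ρ f)).mpr ?_ hw
  rintro w ⟨l, hl, rfl⟩
  have := contract_listProd ρ f l
  rw [hf, zero_smul, sub_zero] at this
  exact low_mono (Nat.lt_succ_iff.mp hl) this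

/-- The linear form on `U(L)` obtained from the augmentation by successive contractions. -/
def contractForm (f : ι → A →ₗ[K] K) : List ι → UniversalEnvelopingAlgebra K L →ₗ[K] K
  | [] => (lift K (0 : L →ₗ⁅K⁆ K)).toLinearMap
  | i :: l => contractForm f l ∘ₗ contract ρ (f i)

/-- Each contraction lowers the degree by one. As `low` uses a strict bound, `low 0 = ⊥` is reached
after `l.length` steps. -/
theorem contractForm_eq_zero {f : ι → A →ₗ[K] K} (hf : ∀ i, f i 1 = 0) (l : List ι)
    {w : UniversalEnvelopingAlgebra K L} (hw : w ∈ low K L l.length) :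
    contractForm ρ f l w = 0 := by
  induction l generalizing w with
  | nil =>
    have : low K L ([] : List ι).length = ⊥ := by simp [low]
    rw [this, Submodule.mem_bot] at hw
    rw [hw, map_zero]
  | cons i l ih => exact ih (contract_mem_low ρ (hf i) hw)

variable [DecidableEq ι] {e : ι → L} {f : ι → A →ₗ[K] K}

/-- On leading terms, contraction with `f i` acts as the partial derivative in the direction `e i`.
For the empty list the truncated subtraction is harmless, since the contraction vanishes. -/
theorem contract_listProd_dual (hf : ∀ i, f i 1 = 0)
    (hfe : ∀ i j, f i (ρ (e j)) = if i = j then 1 else 0) (i : ι) (l : List ι) :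
    contract ρ (f i) (listProd (l.map e)) - (l.count i : K) • listProd ((l.erase i).map e) ∈
      low K L (l.length - 1) := by
  induction l with
  | nil => simp [contract_one, hf]
  | cons j l ih =>
    rw [List.map_cons, listProd_cons, contract_ι_mul, List.length_cons, Nat.add_sub_cancel]
    have h1 := contract_listProd ρ (f i ∘ₗ LinearMap.mulLeft K (ρ (e j))) (l.map e)
    rw [List.length_map, LinearMap.comp_apply, LinearMap.mulLeft_apply, mul_one, hfe] at h1
    have h2 : UniversalEnvelopingAlgebra.ι K (e j) * (contract ρ (f i) (listProd (l.map e)) -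
        (l.count i : K) • listProd ((l.erase i).map e)) ∈ low K L l.length := by
      rcases l with _ | ⟨k, l⟩
      · simp [contract_one, hf]
      · simpa using ι_mul_mem_low (e j) ih
    by_cases hij : i = j
    · subst hij
      rw [if_pos rfl, one_smul] at h1
      have h3 : (l.count i : K) • (UniversalEnvelopingAlgebra.ι K (e i) *
          listProd ((l.erase i).map e) - listProd (l.map e)) ∈ low K L l.length := by
        by_cases hi : i ∈ l
        · have := listProd_sub_mem_low_of_perm (K := K) ((List.perm_cons_erase hi).map e).symm
          rw [List.map_cons, listProd_cons, List.length_cons, List.length_map,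
            List.length_erase_of_mem hi, Nat.sub_add_cancel (List.length_pos_of_mem hi)] at this
          exact Submodule.smul_mem _ _ this
        · simp [List.count_eq_zero_of_not_mem hi]
      rw [List.erase_cons_head, List.count_cons_self]
      convert add_mem (add_mem h1 h2) h3 using 1
      rw [mul_sub, mul_smul_comm, smul_sub, Nat.cast_add, Nat.cast_one, add_smul, one_smul]
      abel
    · rw [if_neg hij, zero_smul, sub_zero] at h1
      rw [List.erase_cons_tail (by simpa using Ne.symm hij), List.count_cons_of_ne (Ne.symm hij),
        List.map_cons, listProd_cons, ← mul_smul_comm, add_sub_assoc, ← mul_sub]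
      exact add_mem h1 h2

/-- Iterated derivatives of a monomial of the same degree: the value is a product of multiplicities,
nonzero in characteristic zero precisely when all indices match. -/
theorem contractForm_listProd_ne_zero_iff [CharZero K] (hf : ∀ i, f i 1 = 0)
    (hfe : ∀ i j, f i (ρ (e j)) = if i = j then 1 else 0) {l l' : List ι}
    (h : l.length = l'.length) :
    contractForm ρ f l (listProd (l'.map e)) ≠ 0 ↔ l.Perm l' := by
  induction l generalizing l' with
  | nil =>
    obtain rfl : l' = [] := List.eq_nil_of_length_eq_zero h.symm
    simp [contractForm]
  | cons i l ih =>
    rw [List.length_cons] at h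
    have h1 := contract_listProd_dual ρ hf hfe i l'
    rw [← h, Nat.add_sub_cancel] at h1
    have h2 := contractForm_eq_zero ρ hf l h1
    rw [map_sub, map_smul, sub_eq_zero] at h2
    rw [contractForm, LinearMap.comp_apply, h2, List.cons_perm_iff_perm_erase, smul_eq_mul,
      mul_ne_zero_iff, Nat.cast_ne_zero, Ne, List.count_eq_zero, not_not]
    refine and_congr_right fun hi => ih ?_
    rw [List.length_erase_of_mem hi, ← h, Nat.add_sub_cancel]

/-- In a linear relation, the form attached to a monomial of maximal length kills every other term.
-/
theorem linearIndependent_listProd [CharZero K] (hf : ∀ i, f i 1 = 0)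
    (hfe : ∀ i j, f i (ρ (e j)) = if i = j then 1 else 0) {J : Type*} {s : J → List ι}
    (hs : ∀ j j', (s j).Perm (s j') → j = j') :
    LinearIndependent K fun j => listProd (K := K) ((s j).map e) := by
  rw [linearIndependent_iff]
  intro c hc
  by_contra h0
  obtain ⟨j, hj, hmax⟩ := Finset.exists_max_image c.support (fun j => (s j).length)
    (Finsupp.support_nonempty_iff.mpr h0)
  have h1 := congrArg (contractForm ρ f (s j)) hc
  rw [Finsupp.linearCombination_apply, Finsupp.sum, map_sum, map_zero, Finset.sum_eq_single_of_mem j hj,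
    map_smul, smul_eq_mul, mul_eq_zero] at h1
  · rcases h1 with h1 | h1
    · exact Finsupp.mem_support_iff.mp hj h1
    · exact (contractForm_listProd_ne_zero_iff ρ hf hfe rfl).mpr (List.Perm.refl _) h1
  · intro k hk hkj
    rw [map_smul]
    rcases (hmax k hk).lt_or_eq with hlt | heq
    · rw [contractForm_eq_zero ρ hf _ (listProd_mem_low (by simpa using hlt)), smul_zero]
    · have := (contractForm_listProd_ne_zero_iff ρ hf hfe (l := s j) (l' := s k) heq.symm).not.mpr
        fun hp => hkj (hs _ _ hp).symm
      rw [not_not.mp this, smul_zero]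

end Contraction

end UniversalEnvelopingAlgebra

/-! ### Normal ordering and faithfulness of the Weyl algebra action -/

namespace WeylAlgebra

section CommRing

variable (K : Type*) [CommRing K] {n : ℕ}

/-- The generator `x_i` of the Weyl algebra. -/
def x (i : Fin n) : WeylAlgebra K n := RingQuot.mkAlgHom K (Rel K n) (FreeAlgebra.ι K (Sum.inl i))

/-- The generator `∂_i` of the Weyl algebra. -/
def d (i : Fin n) : WeylAlgebra K n := RingQuot.mkAlgHom K (Rel K n) (FreeAlgebra.ι K (Sum.inr i))

theorem x_mul_comm (i j : Fin n) : x K i * x K j = x K j * x K i := by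
  simpa [x] using RingQuot.mkAlgHom_rel K (Rel.x_comm (K := K) i j)

theorem d_mul_comm (i j : Fin n) : d K i * d K j = d K j * d K i := by
  simpa [d] using RingQuot.mkAlgHom_rel K (Rel.d_comm (K := K) i j)

theorem d_mul_x (i j : Fin n) : d K j * x K i = x K i * d K j + if i = j then 1 else 0 := by
  have := RingQuot.mkAlgHom_rel K (Rel.d_x (K := K) i j)
  rw [map_sub, map_mul, map_mul, sub_eq_iff_eq_add'] at this
  rw [d, x, this]
  split_ifs <;> simp

theorem action_x (i : Fin n) :
    action K n (x K i) = LinearMap.mulLeft K (MvPolynomial.X i) := by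
  simp [action, x, genAction]

theorem action_d (i : Fin n) :
    action K n (d K i) = (MvPolynomial.pderiv i).toLinearMap := by
  simp [action, d, genAction]

variable {K} in
theorem induction_left {p : WeylAlgebra K n → Prop} (one : p 1)
    (x_mul : ∀ i w, p w → p (x K i * w)) (d_mul : ∀ i w, p w → p (d K i * w))
    (add : ∀ a b, p a → p b → p (a + b)) (smul : ∀ (c : K) a, p a → p (c • a))
    (w : WeylAlgebra K n) : p w := by
  suffices h : ∀ v, p v → p (w * v) by simpa using h 1 one
  obtain ⟨w, rfl⟩ := RingQuot.mkAlgHom_surjective K (Rel K n) w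
  induction w using FreeAlgebra.induction with
  | grade0 r => intro v hv; rw [AlgHom.commutes, ← Algebra.smul_def]; exact smul r v hv
  | grade1 i =>
    intro v hv
    cases i with
    | inl i => exact x_mul i v hv
    | inr i => exact d_mul i v hv
  | mul a b ha hb => intro v hv; rw [map_mul, mul_assoc]; exact ha _ (hb _ hv)
  | add a b ha hb => intro v hv; rw [map_add, add_mul]; exact add _ _ (ha _ hv) (hb _ hv)

variable {K}

/-- The homomorphism from a polynomial algebra given by a family of commuting elements. -/
def commAeval {A : Type*} [Ring A] [Algebra K A] (a : Fin n → A)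
    (ha : ∀ i j, a i * a j = a j * a i) : MvPolynomial (Fin n) K →ₐ[K] A :=
  -- The subalgebra generated by commuting elements is commutative, so ordinary polynomial
  -- evaluation applies inside it.
  letI : CommRing (Algebra.adjoin K (Set.range a)) :=
    { (inferInstance : Ring (Algebra.adjoin K (Set.range a))) with
      mul_comm := (Algebra.isMulCommutative_adjoin K (s := Set.range a)
        (by rintro _ ⟨i, rfl⟩ _ ⟨j, rfl⟩; exact ha i j)).is_comm.comm }
  (Algebra.adjoin K (Set.range a)).val.comp
    (MvPolynomial.aeval fun i => ⟨a i, Algebra.subset_adjoin ⟨i, rfl⟩⟩)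

theorem commAeval_X {A : Type*} [Ring A] [Algebra K A] (a : Fin n → A)
    (ha : ∀ i j, a i * a j = a j * a i) (i : Fin n) :
    commAeval a ha (MvPolynomial.X i : MvPolynomial (Fin n) K) = a i := by
  simp [commAeval]

variable (K n) in
/-- The multiplication operators in the Weyl algebra. -/
def ofX : MvPolynomial (Fin n) K →ₐ[K] WeylAlgebra K n := commAeval (x K) (x_mul_comm K)

variable (K n) in
/-- The differential operators with constant coefficients in the Weyl algebra. -/
def ofD : MvPolynomial (Fin n) K →ₐ[K] WeylAlgebra K n := commAeval (d K) (d_mul_comm K)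

theorem ofX_X (i : Fin n) : ofX K n (MvPolynomial.X i) = x K i := commAeval_X _ _ i

theorem ofD_X (i : Fin n) : ofD K n (MvPolynomial.X i) = d K i := commAeval_X _ _ i

theorem action_ofX (p : MvPolynomial (Fin n) K) :
    action K n (ofX K n p) = LinearMap.mulLeft K p := by
  have : (action K n).comp (ofX K n) = Algebra.lmul K (MvPolynomial (Fin n) K) := by
    ext i : 1
    rw [AlgHom.comp_apply, ofX_X, action_x]
    rfl
  exact DFunLike.congr_fun this p

theorem d_mul_ofX (i : Fin n) (p : MvPolynomial (Fin n) K) :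
    d K i * ofX K n p = ofX K n p * d K i + ofX K n (MvPolynomial.pderiv i p) := by
  induction p using MvPolynomial.induction_on with
  | C a => simp [← MvPolynomial.algebraMap_eq, (Algebra.commutes a (d K i)).symm]
  | add p q hp hq => simp only [map_add, mul_add, add_mul, hp, hq]; abel
  | mul_X p j hp =>
    rw [map_mul, ← mul_assoc, hp, add_mul, mul_assoc, ofX_X, d_mul_x, Derivation.leibniz,
      MvPolynomial.pderiv_X, Pi.single_apply, smul_eq_mul, smul_eq_mul, mul_comm (MvPolynomial.X j),
      map_add, map_mul, map_mul, ofX_X, mul_add, ← mul_assoc]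
    split_ifs <;> simp [add_assoc]

variable (K n) in
/-- The normal ordering map, sending a family of polynomials `p_b` to `∑ p_b ∂^b`. -/
def normalOrder : ((Fin n →₀ ℕ) →₀ MvPolynomial (Fin n) K) →ₗ[K] WeylAlgebra K n :=
  Finsupp.lsum K fun b =>
    (LinearMap.mulRight K (ofD K n (MvPolynomial.monomial b 1))) ∘ₗ (ofX K n).toLinearMap

theorem normalOrder_single (b : Fin n →₀ ℕ) (p : MvPolynomial (Fin n) K) :
    normalOrder K n (Finsupp.single b p) = ofX K n p * ofD K n (MvPolynomial.monomial b 1) := by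
  simp [normalOrder]

theorem normalOrder_surjective : Function.Surjective (normalOrder K n) := by
  rw [← LinearMap.range_eq_top, Submodule.eq_top_iff']
  intro w
  induction w using induction_left with
  | one =>
    refine ⟨Finsupp.single 0 1, ?_⟩
    rw [normalOrder_single, ← MvPolynomial.C_apply]
    simp
  | x_mul i w hw =>
    obtain ⟨f, rfl⟩ := hw
    induction f using Finsupp.induction_linear with
    | zero => simp
    | add f g hf hg => rw [map_add, mul_add]; exact add_mem hf hg
    | single b p =>
      refine ⟨Finsupp.single b (MvPolynomial.X i * p), ?_⟩
      rw [normalOrder_single, normalOrder_single, map_mul, ofX_X, mul_assoc]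
  | d_mul i w hw =>
    obtain ⟨f, rfl⟩ := hw
    induction f using Finsupp.induction_linear with
    | zero => simp
    | add f g hf hg => rw [map_add, mul_add]; exact add_mem hf hg
    | single b p =>
      refine ⟨Finsupp.single (Finsupp.single i 1 + b) p +
        Finsupp.single b (MvPolynomial.pderiv i p), ?_⟩
      rw [map_add, normalOrder_single, normalOrder_single, normalOrder_single, ← mul_assoc,
        d_mul_ofX, add_mul, mul_assoc, ← ofD_X, ← map_mul, MvPolynomial.X,
        MvPolynomial.monomial_mul, one_mul]
  | add a b ha hb => exact add_mem ha hb
  | smul c a ha => exact Submodule.smul_mem _ _ ha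

end CommRing

variable {K : Type*} [Field K] [CharZero K] {n : ℕ}

/-- For degree reasons `∂^b x^c` is constant; it is `b!` if `b = c`, and otherwise some exponent of
`b` exceeds that of `c` and the result is zero. -/
theorem exists_action_ofD_monomial (b c : Fin n →₀ ℕ) (h : c.degree ≤ b.degree) :
    ∃ r : K, action K n (ofD K n (MvPolynomial.monomial b 1)) (MvPolynomial.monomial c 1) =
      MvPolynomial.C r ∧ (r ≠ 0 ↔ b = c) := by
  induction hm : b.degree generalizing b c with
  | zero =>
    obtain rfl := (Finsupp.degree_eq_zero_iff b).mp hm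
    obtain rfl := (Finsupp.degree_eq_zero_iff c).mp (Nat.le_zero.mp (hm ▸ h))
    exact ⟨1, by rw [← MvPolynomial.C_apply]; simp, by simp⟩
  | succ m ih =>
    obtain ⟨i, hi⟩ : ∃ i, b i ≠ 0 := by
      by_contra! h0
      obtain rfl : b = 0 := Finsupp.ext h0
      simp at hm
    obtain ⟨b, rfl⟩ : ∃ b', b = b' + Finsupp.single i 1 :=
      ⟨b - Finsupp.single i 1, (tsub_add_cancel_of_le
        (Finsupp.single_le_iff.mpr (Nat.one_le_iff_ne_zero.mpr hi))).symm⟩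
    rw [map_add, Finsupp.degree_single, Nat.add_right_cancel_iff] at hm
    have h1 : MvPolynomial.monomial (b + Finsupp.single i 1) (1 : K) =
        MvPolynomial.monomial b 1 * MvPolynomial.X i := by
      rw [MvPolynomial.X, MvPolynomial.monomial_mul, one_mul]
    have h2 : action K n (ofD K n (MvPolynomial.monomial (b + Finsupp.single i 1) 1))
          (MvPolynomial.monomial c 1) = (c i : K) •
        action K n (ofD K n (MvPolynomial.monomial b 1))
          (MvPolynomial.monomial (c - Finsupp.single i 1) 1) := by
      rw [h1, map_mul, ofD_X, map_mul, Module.End.mul_apply, action_d, Derivation.coeFn_coe,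
        MvPolynomial.pderiv_monomial, ← map_smul, MvPolynomial.smul_monomial, one_mul, smul_eq_mul,
        mul_one]
    rw [h2]
    by_cases hc : c i = 0
    · refine ⟨0, by simp [hc], by simp, ?_⟩
      rintro rfl
      simp at hc
    · obtain ⟨c, rfl⟩ : ∃ c', c = c' + Finsupp.single i 1 :=
        ⟨c - Finsupp.single i 1, (tsub_add_cancel_of_le
          (Finsupp.single_le_iff.mpr (Nat.one_le_iff_ne_zero.mpr hc))).symm⟩
      rw [add_tsub_cancel_right]
      obtain ⟨r, hr, hr0⟩ := ih b c (by simpa using h) hm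
      refine ⟨(((c + Finsupp.single i 1 : Fin n →₀ ℕ) i : ℕ) : K) * r, ?_, ?_⟩
      · rw [hr, MvPolynomial.smul_eq_C_mul, ← map_mul]
      · rw [mul_ne_zero_iff, Nat.cast_ne_zero, add_left_inj]
        exact ⟨fun h => hr0.mp h.2, fun h => ⟨hc, hr0.mpr h⟩⟩

/-- Write an element as `∑ p_b ∂^b` and choose `b` of minimal degree with `p_b ≠ 0`. Applied to
`x^b`, only this term survives, and it gives a nonzero multiple of `p_b`. -/
theorem action_injective : Function.Injective (action K n) := by
  rw [injective_iff_map_eq_zero]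
  intro w hw
  obtain ⟨f, rfl⟩ := normalOrder_surjective w
  by_contra hne
  have hf : f ≠ 0 := by rintro rfl; exact hne (map_zero _)
  obtain ⟨b, hb, hmin⟩ := Finset.exists_min_image f.support Finsupp.degree
    (Finsupp.support_nonempty_iff.mpr hf)
  have h := DFunLike.congr_fun hw (MvPolynomial.monomial b (1 : K))
  have hsum : normalOrder K n f =
      ∑ c ∈ f.support, ofX K n (f c) * ofD K n (MvPolynomial.monomial c 1) := by
    simp [normalOrder, Finsupp.sum]
  rw [hsum, map_sum, LinearMap.sum_apply, Finset.sum_eq_single_of_mem b hb, map_mul,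
    Module.End.mul_apply, action_ofX, LinearMap.mulLeft_apply, LinearMap.zero_apply] at h
  · obtain ⟨r, hr, hr0⟩ := exists_action_ofD_monomial (K := K) b b le_rfl
    rw [hr, mul_eq_zero, MvPolynomial.C_eq_zero] at h
    exact h.elim (Finsupp.mem_support_iff.mp hb) (hr0.mpr rfl)
  · intro c hc hcb
    obtain ⟨r, hr, hr0⟩ := exists_action_ofD_monomial (K := K) c b (hmin c hc)
    rw [map_mul, Module.End.mul_apply, hr, not_not.mp (hr0.not.mpr hcb), map_zero, map_zero]

end WeylAlgebra

/-! ### Sorted index lists as representatives of multisets -/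

section SortedList

variable {n m : ℕ}

/-- The weakly increasing list of indices in which `i` occurs `a i` times. -/
def sortedList (a : Fin n →₀ ℕ) : List (Fin n) := (List.ofFn fun i => List.replicate (a i) i).flatten

theorem count_sortedList (a : Fin n →₀ ℕ) (i : Fin n) : (sortedList a).count i = a i := by
  simp [sortedList, List.count_flatten, List.map_ofFn, List.sum_ofFn, Function.comp_def,
    List.count_replicate]

theorem exists_sortedList_perm (l : List (Fin n)) : ∃ a, (sortedList a).Perm l :=
  ⟨Finsupp.equivFunOnFinite.symm fun i => l.count i,
    List.perm_iff_count.mpr fun i => by rw [count_sortedList]; rfl⟩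

instance sumLawfulBEq {α β : Type*} [BEq α] [BEq β] [LawfulBEq α] [LawfulBEq β] :
    LawfulBEq (α ⊕ β) where
  eq_of_beq {a b} h := by
    cases a <;> cases b <;> first | exact congrArg _ (eq_of_beq h) | cases h
  rfl {a} := by
    cases a with
    | inl x => exact (beq_self_eq_true x : (x == x) = true)
    | inr x => exact (beq_self_eq_true x : (x == x) = true)

/-- The sorted list of indices of the first kind followed by that of indices of the second kind. -/
def sortedSumList (c : (Fin n →₀ ℕ) × (Fin m →₀ ℕ)) : List (Fin n ⊕ Fin m) :=
  (sortedList c.1).map Sum.inl ++ (sortedList c.2).map Sum.inr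

theorem count_inl_sortedSumList (c : (Fin n →₀ ℕ) × (Fin m →₀ ℕ)) (i : Fin n) :
    (sortedSumList c).count (Sum.inl i) = c.1 i := by
  rw [sortedSumList, List.count_append, List.count_map_of_injective _ _ Sum.inl_injective,
    count_sortedList, List.count_eq_zero_of_not_mem (by simp), add_zero]

theorem count_inr_sortedSumList (c : (Fin n →₀ ℕ) × (Fin m →₀ ℕ)) (i : Fin m) :
    (sortedSumList c).count (Sum.inr i) = c.2 i := by
  rw [sortedSumList, List.count_append, List.count_map_of_injective _ _ Sum.inr_injective,
    count_sortedList, List.count_eq_zero_of_not_mem (by simp), zero_add]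

theorem exists_sortedSumList_perm (l : List (Fin n ⊕ Fin m)) : ∃ c, (sortedSumList c).Perm l := by
  refine ⟨⟨Finsupp.equivFunOnFinite.symm fun i => l.count (Sum.inl i),
    Finsupp.equivFunOnFinite.symm fun i => l.count (Sum.inr i)⟩, List.perm_iff_count.mpr ?_⟩
  rintro (i | i)
  · rw [count_inl_sortedSumList]; rfl
  · rw [count_inr_sortedSumList]; rfl

theorem eq_of_sortedSumList_perm (c c' : (Fin n →₀ ℕ) × (Fin m →₀ ℕ))
    (h : (sortedSumList c).Perm (sortedSumList c')) : c = c' := by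
  have h' := List.perm_iff_count.mp h
  refine Prod.ext (Finsupp.ext fun i => ?_) (Finsupp.ext fun i => ?_)
  · simpa only [count_inl_sortedSumList] using h' (Sum.inl i)
  · simpa only [count_inr_sortedSumList] using h' (Sum.inr i)

end SortedList

/-! ### The PBW basis of the generalized Verma module -/

section InducedModules

attribute [local instance] LieRing.ofAssociativeRing

open UniversalEnvelopingAlgebra

section Monomials

variable {K g : Type*} [Field K] [LieRing g] [LieAlgebra K g] {n : ℕ}

theorem listProd_sortedList (u : Fin n → g) (a : Fin n →₀ ℕ) :
    listProd (K := K) ((sortedList a).map u) = pbwMonomial u a := by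
  simp [listProd, sortedList, pbwMonomial, List.map_flatten, List.map_ofFn, List.prod_flatten,
    Function.comp_def, -ι_apply]

theorem uMap_ι (p : LieSubalgebra K g) (x : p) :
    uMap p (UniversalEnvelopingAlgebra.ι K x) = UniversalEnvelopingAlgebra.ι K (x : g) := by
  rw [uMap, lift_ι_apply]
  rfl

theorem uMap_pbwMonomial (p : LieSubalgebra K g) (q : Fin n → p) (b : Fin n →₀ ℕ) :
    uMap p (pbwMonomial q b) = pbwMonomial (fun i => (q i : g)) b := by
  simp only [pbwMonomial, map_list_prod, List.map_ofFn, Function.comp_def, map_pow, uMap_ι]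

variable (K g) in
/-- The augmentation of the universal enveloping algebra. -/
def augmentation : UniversalEnvelopingAlgebra K g →ₐ[K] K := lift K 0

@[simp] theorem augmentation_ι (x : g) :
    augmentation K g (UniversalEnvelopingAlgebra.ι K x) = 0 := by
  rw [augmentation, lift_ι_apply]
  rfl

theorem augmentation_pbwMonomial (u : Fin n → g) (a : Fin n →₀ ℕ) :
    augmentation K g (pbwMonomial u a) = if a = 0 then 1 else 0 := by
  simp only [pbwMonomial, map_list_prod, List.map_ofFn, Function.comp_def, map_pow, augmentation_ι,
    List.prod_ofFn]
  split_ifs with h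
  · simp [h]
  · obtain ⟨i, hi⟩ := DFunLike.ne_iff.mp h
    exact Finset.prod_eq_zero (Finset.mem_univ i) (zero_pow hi)

theorem pbwMonomial_zero (u : Fin n → g) : pbwMonomial (K := K) u 0 = 1 := by
  simp [pbwMonomial]

theorem span_pbwMonomial_eq_top {u : Fin n → g} (hu : Submodule.span K (Set.range u) = ⊤) :
    Submodule.span K (Set.range (pbwMonomial (K := K) u)) = ⊤ := by
  rw [← span_listProd_eq_top hu exists_sortedList_perm]
  simp only [listProd_sortedList]

end Monomials

section FaithfulAdjoint

variable {K g ι : Type*} [Field K] [LieRing g] [LieAlgebra K g] [DecidableEq ι]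

/-- A family of linear forms on a faithful representation which vanish on the identity and are dual
to a basis of the Lie algebra. -/
theorem exists_dual_forms (e : Module.Basis ι K g)
    (hg : Function.Injective (LieAlgebra.ad K g)) :
    ∃ (ρ : g →ₗ⁅K⁆ (Module.End K g × K)) (f : ι → (Module.End K g × K) →ₗ[K] K),
      (∀ i, f i 1 = 0) ∧ ∀ i j, f i (ρ (e j)) = if i = j then 1 else 0 := by
  obtain ⟨h, hh⟩ := LinearMap.exists_leftInverse_of_injective
    (LieAlgebra.ad K g : g →ₗ[K] Module.End K g) (LinearMap.ker_eq_bot.mpr hg)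
  have hh' (x : g) : h (LieAlgebra.ad K g x) = x := DFunLike.congr_fun hh x
  -- The extra factor `K` carries the zero representation. It does not change the values on `ρ`, but
  -- it sees the identity, so subtracting a multiple of `snd` forces `f i 1 = 0`.
  refine ⟨{ toLinearMap := LinearMap.inl K _ K ∘ₗ (LieAlgebra.ad K g : g →ₗ[K] Module.End K g)
            map_lie' := fun {x y} => ?_ },
    fun i => e.coord i ∘ₗ h ∘ₗ LinearMap.fst K _ K - e.coord i (h 1) • LinearMap.snd K _ K,
    fun i => ?_, fun i j => ?_⟩
  · simp [LieRing.of_associative_ring_bracket]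
  · simp
  · change e.coord i (h (LieAlgebra.ad K g (e j))) - e.coord i (h 1) • (0 : K) = _
    rw [hh', smul_zero, sub_zero, Module.Basis.coord_apply, Module.Basis.repr_self,
      Finsupp.single_apply]
    simp only [eq_comm]

end FaithfulAdjoint

section Induced

variable {K g : Type*} [Field K] [LieRing g] [LieAlgebra K g] (p : LieSubalgebra K g)

theorem lift_toEnd_trivial (c : UniversalEnvelopingAlgebra K p) (v : TrivialLieModule K p K) :
    UniversalEnvelopingAlgebra.lift K (LieModule.toEnd K p (TrivialLieModule K p K)) c v =
      augmentation K p c • v := by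
  have h : UniversalEnvelopingAlgebra.lift K (LieModule.toEnd K p (TrivialLieModule K p K)) =
      (Algebra.ofId K _).comp (augmentation K p) := by
    ext x : 2
    simp only [LieHom.comp_apply, AlgHom.coe_toLieHom, lift_ι_apply, AlgHom.comp_apply,
      augmentation_ι, map_zero]
    exact LinearMap.ext fun v => trivial_lie_zero p _ x v
  rw [h]
  simp [Algebra.ofId_apply]

theorem genVermaTmul_mul (w w' : UniversalEnvelopingAlgebra K g) :
    genVermaTmul p (w * w') = w • genVermaTmul p w' := by
  rw [genVermaTmul, genVermaTmul, inducedTmul, inducedTmul, ← map_smul]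
  rfl

/-- The `K`-linear map `w ↦ w ⊗ m_1`. -/
def genVermaTmulₗ : UniversalEnvelopingAlgebra K g →ₗ[K] GenVerma₀ p where
  toFun := genVermaTmul p
  map_add' a b := by simp [genVermaTmul, inducedTmul, TensorProduct.add_tmul]
  map_smul' c a := by
    simp only [genVermaTmul, inducedTmul, RingHom.id_apply]
    rfl

theorem genVermaTmulₗ_apply (w : UniversalEnvelopingAlgebra K g) :
    genVermaTmulₗ p w = genVermaTmul p w := rfl

theorem genVermaTmulₗ_surjective : Function.Surjective (genVermaTmulₗ p) := by
  rw [← LinearMap.range_eq_top, Submodule.eq_top_iff']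
  intro z
  obtain ⟨z, rfl⟩ := (inducedRel p _).mkQ_surjective z
  induction z using TensorProduct.induction_on with
  | zero => simp
  | add a b ha hb => rw [map_add]; exact add_mem ha hb
  | tmul w v =>
    obtain ⟨r, rfl⟩ := (TrivialLieModule.equiv K p K).symm.surjective v
    refine ⟨r • w, ?_⟩
    change (inducedRel p _).mkQ ((r • w) ⊗ₜ _) = _
    rw [TensorProduct.smul_tmul, ← map_smul, smul_eq_mul, mul_one]

theorem genVermaTmul_mul_uMap (w : UniversalEnvelopingAlgebra K g)
    (c : UniversalEnvelopingAlgebra K p) :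
    genVermaTmul p (w * uMap p c) = augmentation K p c • genVermaTmul p w := by
  have h : (w * uMap p c) ⊗ₜ[K] ((TrivialLieModule.equiv K p K).symm 1) -
      w ⊗ₜ[K] (augmentation K p c • (TrivialLieModule.equiv K p K).symm 1) ∈
      inducedRel p (TrivialLieModule K p K) :=
    Submodule.subset_span ⟨w, c, _, by rw [lift_toEnd_trivial]⟩
  rw [← TensorProduct.smul_tmul, ← Submodule.Quotient.mk_eq_zero, Submodule.Quotient.mk_sub,
    sub_eq_zero] at h
  exact h.trans (map_smul (genVermaTmulₗ p) _ w)

/-- A linear map on `U(g)` which is compatible with the augmentation of `U(p)` descends to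
`M_0(g, p)`. -/
theorem exists_descend {V : Type*} [AddCommGroup V] [Module K V]
    (ψ : UniversalEnvelopingAlgebra K g →ₗ[K] V)
    (hψ : ∀ w c, ψ (w * uMap p c) = augmentation K p c • ψ w) :
    ∃ φ : GenVerma₀ p →ₗ[K] V, ∀ w, φ (genVermaTmul p w) = ψ w := by
  let F : UniversalEnvelopingAlgebra K g ⊗[K] TrivialLieModule K p K →ₗ[K] V :=
    TensorProduct.lift ((LinearMap.lsmul K V).flip.compl₂
      (TrivialLieModule.equiv K p K).toLinearMap ∘ₗ ψ)
  have hF (w v) : F (w ⊗ₜ v) = TrivialLieModule.equiv K p K v • ψ w := rfl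
  have hker : (inducedRel p (TrivialLieModule K p K)).restrictScalars K ≤ LinearMap.ker F := by
    intro z hz
    rw [Submodule.restrictScalars_mem] at hz
    -- `F` is only `K`-linear while the relations are spanned over `U(g)`, so the claim is
    -- strengthened to all multiples of `z`.
    suffices h : ∀ w : UniversalEnvelopingAlgebra K g, F (w • z) = 0 by simpa using h 1
    induction hz using Submodule.span_induction with
    | mem z h =>
      obtain ⟨a, c, v, rfl⟩ := h
      intro w
      rw [smul_sub, TensorProduct.smul_tmul', TensorProduct.smul_tmul', map_sub, hF, hF,
        lift_toEnd_trivial, smul_eq_mul, smul_eq_mul, ← mul_assoc, hψ, map_smul, smul_eq_mul,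
        mul_comm, mul_smul, smul_comm, sub_self]
    | zero => simp
    | add a b _ _ ha hb => intro w; rw [smul_add, map_add, ha, hb, add_zero]
    | smul c a _ ha => intro w; rw [smul_smul]; exact ha _
  refine ⟨((inducedRel p (TrivialLieModule K p K)).restrictScalars K).liftQ F hker ∘ₗ
    (Submodule.Quotient.restrictScalarsEquiv K _).symm.toLinearMap, fun w => ?_⟩
  change F (w ⊗ₜ _) = _
  rw [hF, LinearEquiv.apply_symm_apply, one_smul]

variable {p} {n m : ℕ} {u : Fin n → g}

/-- The Poincaré-Birkhoff-Witt basis of `M_0(g, p)`. -/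
theorem exists_genVerma_equiv [CharZero K] (hg : Function.Injective (LieAlgebra.ad K g))
    (q : Module.Basis (Fin m) K p) (e : Module.Basis (Fin n ⊕ Fin m) K g)
    (hu : ∀ i, e (Sum.inl i) = u i) (hq : ∀ j, e (Sum.inr j) = q j) :
    ∃ φ : GenVerma₀ p ≃ₗ[K] MvPolynomial (Fin n) K,
      ∀ a, φ (genVermaTmul p (pbwMonomial u a)) = MvPolynomial.monomial a 1 := by
  obtain ⟨ρ, f, hf1, hfe⟩ := exists_dual_forms e hg
  have hmon (c : (Fin n →₀ ℕ) × (Fin m →₀ ℕ)) :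
      listProd (K := K) ((sortedSumList c).map e) = pbwMonomial u c.1 * uMap p (pbwMonomial q c.2) := by
    rw [sortedSumList, List.map_append, List.map_map, List.map_map, listProd_append,
      show e ∘ Sum.inl = u from funext hu, show e ∘ Sum.inr = fun j => (q j : g) from funext hq,
      listProd_sortedList, listProd_sortedList, uMap_pbwMonomial]
  let B : Module.Basis ((Fin n →₀ ℕ) × (Fin m →₀ ℕ)) K (UniversalEnvelopingAlgebra K g) :=
    Module.Basis.mk (linearIndependent_listProd ρ hf1 hfe eq_of_sortedSumList_perm)
      (span_listProd_eq_top e.span_eq exists_sortedSumList_perm).ge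
  have hB (c) : B c = pbwMonomial u c.1 * uMap p (pbwMonomial q c.2) := by
    rw [Module.Basis.mk_apply, hmon]
  -- In terms of `U(g) = U(n₋) ⊗ U(p)`, this applies the augmentation to the second factor, as `hψ0`
  -- confirms.
  let ψ : UniversalEnvelopingAlgebra K g →ₗ[K] MvPolynomial (Fin n) K :=
    B.constr K fun c => if c.2 = 0 then MvPolynomial.monomial c.1 1 else 0
  have hψB (c) : ψ (pbwMonomial u (Prod.fst c) * uMap p (pbwMonomial q c.2)) =
      if c.2 = 0 then MvPolynomial.monomial c.1 1 else 0 := by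
    rw [← hB, Module.Basis.constr_basis]
  have hψu (a) : ψ (pbwMonomial u a) = MvPolynomial.monomial a 1 := by
    simpa [pbwMonomial_zero] using hψB (a, 0)
  have hψ0 (a) (c : UniversalEnvelopingAlgebra K p) :
      ψ (pbwMonomial u a * uMap p c) = augmentation K p c • MvPolynomial.monomial a 1 := by
    have hc : c ∈ Submodule.span K (Set.range (pbwMonomial (K := K) q)) := by
      rw [span_pbwMonomial_eq_top q.span_eq]; trivial
    induction hc using Submodule.span_induction with
    | mem c h =>
      obtain ⟨b, rfl⟩ := h
      rw [hψB (a, b), augmentation_pbwMonomial, ite_smul, one_smul, zero_smul]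
    | zero => simp
    | add c c' _ _ h h' => rw [map_add, mul_add, map_add, h, h', map_add, add_smul]
    | smul r c _ h => rw [map_smul, mul_smul_comm, map_smul, h, map_smul, smul_assoc]
  have hψ (w) (c : UniversalEnvelopingAlgebra K p) :
      ψ (w * uMap p c) = augmentation K p c • ψ w := by
    have hw : w ∈ Submodule.span K (Set.range B) := B.span_eq ▸ Submodule.mem_top
    induction hw using Submodule.span_induction with
    | mem w h =>
      obtain ⟨b, rfl⟩ := h
      rw [hB, mul_assoc, ← map_mul, hψ0, hψ0, map_mul, smul_smul, mul_comm]
    | zero => simp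
    | add w w' _ _ h h' => rw [add_mul, map_add, h, h', map_add, smul_add]
    | smul r w _ h => rw [smul_mul_assoc, map_smul, h, map_smul, smul_comm]
  obtain ⟨φ, hφ⟩ := exists_descend p ψ hψ
  let χ : MvPolynomial (Fin n) K →ₗ[K] GenVerma₀ p :=
    (MvPolynomial.basisMonomials (Fin n) K).constr K fun a => genVermaTmul p (pbwMonomial u a)
  have hχ (a) : χ (MvPolynomial.monomial a 1) = genVermaTmul p (pbwMonomial u a) := by
    have := (MvPolynomial.basisMonomials (Fin n) K).constr_basis K
      (fun a => genVermaTmul p (pbwMonomial u a)) a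
    rwa [MvPolynomial.coe_basisMonomials] at this
  refine ⟨LinearEquiv.ofLinearMap φ χ ?_ ?_, fun a => by
    rw [LinearEquiv.coe_ofLinearMap, hφ, hψu]⟩
  · refine (MvPolynomial.basisMonomials (Fin n) K).ext fun a => ?_
    rw [MvPolynomial.coe_basisMonomials, LinearMap.comp_apply, hχ, hφ, hψu, LinearMap.id_apply]
  · have h : (χ ∘ₗ φ) ∘ₗ genVermaTmulₗ p = genVermaTmulₗ p := by
      refine B.ext fun c => ?_
      rw [hB, LinearMap.comp_apply, genVermaTmulₗ_apply, LinearMap.comp_apply, hφ, hψ0, map_smul,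
        hχ, genVermaTmul_mul_uMap]
    refine LinearMap.ext fun z => ?_
    obtain ⟨w, rfl⟩ := genVermaTmulₗ_surjective p z
    exact DFunLike.congr_fun h w

end Induced

/-! ### Moving an element across a power -/

section Commutation

variable {K g : Type*} [Field K] [LieRing g] [LieAlgebra K g]

theorem commute_mulLeft_sub_mulRight {A : Type*} [Ring A] [Algebra K A] (y : A) :
    Commute (LinearMap.mulLeft K y) (LinearMap.mulLeft K y - LinearMap.mulRight K y) :=
  (Commute.refl _).sub_right (LinearMap.commute_mulLeft_right (R := K) y y)

theorem mulLeft_sub_mulRight_pow_ι (x y : g) (l : ℕ) :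
    ((LinearMap.mulLeft K (UniversalEnvelopingAlgebra.ι K y) -
      LinearMap.mulRight K (UniversalEnvelopingAlgebra.ι K y)) ^ l)
        (UniversalEnvelopingAlgebra.ι K x) =
      UniversalEnvelopingAlgebra.ι K ((LieAlgebra.ad K g y ^ l) x) := by
  induction l with
  | zero => rfl
  | succ l ih =>
    rw [pow_succ', Module.End.mul_apply, ih, pow_succ', Module.End.mul_apply, LieAlgebra.ad_apply,
      LieHom.map_lie, LieRing.of_associative_ring_bracket]
    rfl

/-- Left multiplication by `y` is the sum of `ad y` and right multiplication by `y`, which commute;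
this is the binomial theorem. -/
theorem ι_pow_mul_ι (x y : g) (k : ℕ) :
    UniversalEnvelopingAlgebra.ι K y ^ k * UniversalEnvelopingAlgebra.ι K x =
      ∑ l ∈ Finset.range (k + 1), (k.choose l : K) •
        (UniversalEnvelopingAlgebra.ι K ((LieAlgebra.ad K g y ^ l) x) *
          UniversalEnvelopingAlgebra.ι K y ^ (k - l)) := by
  have hc : Commute (LinearMap.mulLeft K (UniversalEnvelopingAlgebra.ι K y) -
      LinearMap.mulRight K (UniversalEnvelopingAlgebra.ι K y))
      (LinearMap.mulRight K (UniversalEnvelopingAlgebra.ι K y)) :=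
    (LinearMap.commute_mulLeft_right _ _).sub_left (Commute.refl _)
  have h := DFunLike.congr_fun (hc.add_pow k) (UniversalEnvelopingAlgebra.ι K x)
  rw [sub_add_cancel, LinearMap.pow_mulLeft, LinearMap.mulLeft_apply] at h
  rw [h, LinearMap.sum_apply]
  refine Finset.sum_congr rfl fun l _ => ?_
  rw [← nsmul_eq_mul', LinearMap.smul_apply, (hc.pow_pow l (k - l)).eq, Module.End.mul_apply,
    mulLeft_sub_mulRight_pow_ι, LinearMap.pow_mulRight, LinearMap.mulRight_apply,
    Nat.cast_smul_eq_nsmul]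

/-- The same argument for right multiplication, as left multiplication minus `ad y`; hence the
signs. -/
theorem ι_mul_ι_pow (x y : g) (k : ℕ) :
    UniversalEnvelopingAlgebra.ι K x * UniversalEnvelopingAlgebra.ι K y ^ k =
      ∑ l ∈ Finset.range (k + 1), (k.choose l : K) •
        (UniversalEnvelopingAlgebra.ι K y ^ (k - l) *
          UniversalEnvelopingAlgebra.ι K ((-1 : K) ^ l • (LieAlgebra.ad K g y ^ l) x)) := by
  have hc : Commute (-(LinearMap.mulLeft K (UniversalEnvelopingAlgebra.ι K y) -
      LinearMap.mulRight K (UniversalEnvelopingAlgebra.ι K y)))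
      (LinearMap.mulLeft K (UniversalEnvelopingAlgebra.ι K y)) :=
    (commute_mulLeft_sub_mulRight _).symm.neg_left
  have h := DFunLike.congr_fun (hc.add_pow k) (UniversalEnvelopingAlgebra.ι K x)
  rw [neg_sub, sub_add_cancel, LinearMap.pow_mulRight, LinearMap.mulRight_apply, ← neg_sub] at h
  rw [h, LinearMap.sum_apply]
  refine Finset.sum_congr rfl fun l _ => ?_
  rw [← nsmul_eq_mul', LinearMap.smul_apply, (hc.pow_pow l (k - l)).eq, Module.End.mul_apply,
    LinearMap.pow_mulLeft, LinearMap.mulLeft_apply, Nat.cast_smul_eq_nsmul,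
    ← neg_one_smul K (_ - _), smul_pow, LinearMap.smul_apply, mulLeft_sub_mulRight_pow_ι,
    map_smul]

theorem isNilpotent_bound {x y : g} (h : IsNilpotent (LieAlgebra.ad K g y)) :
    ∃ N, ∀ k, N ≤ k → (LieAlgebra.ad K g y ^ k) x = 0 := by
  obtain ⟨N, hN⟩ := h
  exact ⟨N, fun k hk => by rw [pow_eq_zero_of_le hk hN, LinearMap.zero_apply]⟩

end Commutation

section PartialProducts

variable {K g : Type*} [Field K] [LieRing g] [LieAlgebra K g] {n : ℕ} (u : Fin n → g)

/-- The product of the first `i` factors of an ordered monomial. -/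
def headProd (a : Fin n →₀ ℕ) (i : ℕ) : UniversalEnvelopingAlgebra K g :=
  ((List.ofFn fun j => UniversalEnvelopingAlgebra.ι K (u j) ^ a j).take i).prod

/-- The product of all but the first `i` factors of an ordered monomial. -/
def tailProd (a : Fin n →₀ ℕ) (i : ℕ) : UniversalEnvelopingAlgebra K g :=
  ((List.ofFn fun j => UniversalEnvelopingAlgebra.ι K (u j) ^ a j).drop i).prod

theorem headProd_mul_tailProd (a : Fin n →₀ ℕ) (i : ℕ) :
    headProd (K := K) u a i * tailProd u a i = pbwMonomial u a := by
  rw [headProd, tailProd, ← List.prod_append, List.take_append_drop, pbwMonomial]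

theorem headProd_zero (a : Fin n →₀ ℕ) : headProd (K := K) u a 0 = 1 := by
  simp [headProd]

theorem tailProd_last (a : Fin n →₀ ℕ) : tailProd (K := K) u a n = 1 := by
  rw [tailProd, List.drop_of_length_le (by simp), List.prod_nil]

theorem tailProd_zero (a : Fin n →₀ ℕ) : tailProd (K := K) u a 0 = pbwMonomial u a := by
  rw [← headProd_mul_tailProd u a 0, headProd_zero, one_mul]

theorem headProd_succ (a : Fin n →₀ ℕ) (i : Fin n) :
    headProd (K := K) u a (i + 1) = headProd u a i * UniversalEnvelopingAlgebra.ι K (u i) ^ a i := by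
  rw [headProd, List.prod_take_succ _ _ (by simp), headProd]
  simp

theorem tailProd_eq (a : Fin n →₀ ℕ) (i : Fin n) :
    tailProd (K := K) u a i = UniversalEnvelopingAlgebra.ι K (u i) ^ a i * tailProd u a (i + 1) := by
  rw [tailProd, List.drop_eq_getElem_cons (by simp), List.prod_cons, tailProd]
  simp

theorem headProd_congr {a b : Fin n →₀ ℕ} {i : ℕ} (h : ∀ j : Fin n, j < i → a j = b j) :
    headProd (K := K) u a i = headProd u b i := by
  unfold headProd
  congr 1
  refine List.ext_getElem (by simp) fun j h1 h2 => ?_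
  simp only [List.length_take, List.length_ofFn, lt_min_iff] at h1
  simp [h ⟨j, h1.2⟩ h1.1]

theorem tailProd_congr {a b : Fin n →₀ ℕ} {i : ℕ} (h : ∀ j : Fin n, i ≤ j → a j = b j) :
    tailProd (K := K) u a i = tailProd u b i := by
  unfold tailProd
  congr 1
  refine List.ext_getElem (by simp) fun j h1 h2 => ?_
  simp only [List.length_drop, List.length_ofFn] at h1
  simp [h ⟨i + j, by omega⟩ (Nat.le_add_right _ _)]

end PartialProducts

theorem MvPolynomial.pderiv_pow_monomial {R σ : Type*} [CommRing R] (i : σ) (k : ℕ) (a : σ →₀ ℕ) :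
    ((MvPolynomial.pderiv (R := R) i).toLinearMap ^ k) (MvPolynomial.monomial a 1) =
      ((a i).descFactorial k : R) • MvPolynomial.monomial (a - Finsupp.single i k) 1 := by
  induction k with
  | zero => simp
  | succ k ih =>
    have h1 : a - Finsupp.single i k - Finsupp.single i 1 = a - Finsupp.single i (k + 1) := by
      rw [tsub_tsub, ← Finsupp.single_add]
    have h2 : (a - Finsupp.single i k) i = a i - k := by simp
    rw [pow_succ', Module.End.mul_apply, ih, map_smul, Derivation.coeFn_coe,
      MvPolynomial.pderiv_monomial, Nat.descFactorial_succ, one_mul, h1, h2,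
      MvPolynomial.smul_monomial, MvPolynomial.smul_monomial, smul_eq_mul, smul_eq_mul, mul_one,
      Nat.cast_mul, mul_comm]

theorem MvPolynomial.linearMap_ext_monomial {R σ V : Type*} [CommRing R] [AddCommGroup V]
    [Module R V] {f g : MvPolynomial σ R →ₗ[R] V}
    (h : ∀ a, f (MvPolynomial.monomial a 1) = g (MvPolynomial.monomial a 1)) : f = g :=
  (MvPolynomial.basisMonomials σ R).ext fun a => by
    simpa only [MvPolynomial.coe_basisMonomials] using h a

/-! ### Insertion operators are differential operators -/

section Generators

variable {K g ι : Type*} [Field K] [LieRing g] [LieAlgebra K g] {u : ι → g} {ht : ι → ℕ}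

theorem lie_mem_span (hbr : ∀ i j, ⁅u i, u j⁆ ∈ Submodule.span K (u '' {k | ht j < ht k})) (i : ι)
    (d : ℕ) {v : g} (hv : v ∈ Submodule.span K (u '' {k | d < ht k})) :
    ⁅u i, v⁆ ∈ Submodule.span K (u '' {k | d < ht k}) := by
  induction hv using Submodule.span_induction with
  | mem y hy =>
    obtain ⟨m, hm, rfl⟩ := hy
    rw [Set.mem_ofPred_eq] at hm
    refine Submodule.span_mono (Set.image_mono fun k hk => ?_) (hbr i m)
    rw [Set.mem_ofPred_eq] at hk ⊢
    exact hm.trans hk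
  | zero => simp
  | add a b _ _ ha hb => rw [lie_add]; exact add_mem ha hb
  | smul c a _ ha => rw [lie_smul]; exact Submodule.smul_mem _ _ ha

theorem ad_pow_succ_mem_span
    (hbr : ∀ i j, ⁅u i, u j⁆ ∈ Submodule.span K (u '' {k | ht j < ht k})) (i j : ι) (k : ℕ) :
    (LieAlgebra.ad K g (u i) ^ (k + 1)) (u j) ∈ Submodule.span K (u '' {k | ht j < ht k}) := by
  induction k with
  | zero => simpa using hbr i j
  | succ k ih =>
    rw [pow_succ', Module.End.mul_apply, LieAlgebra.ad_apply]
    exact lie_mem_span hbr i _ ih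

end Generators

section Operators

variable {K g : Type*} [Field K] [LieRing g] [LieAlgebra K g] {n : ℕ}

variable (u : Fin n → g) (ψ : UniversalEnvelopingAlgebra K g →ₗ[K] MvPolynomial (Fin n) K)

/-- The operator `x^a ↦ ψ(u_0^{a_0} ⋯ u_{i-1}^{a_{i-1}} y u_i^{a_i} ⋯)`. -/
def insertOp (i : ℕ) :
    UniversalEnvelopingAlgebra K g →ₗ[K] Module.End K (MvPolynomial (Fin n) K) :=
  ((MvPolynomial.basisMonomials (Fin n) K).constr K).toLinearMap ∘ₗ
    LinearMap.pi fun a => ψ ∘ₗ LinearMap.mulLeft K (headProd u a i) ∘ₗ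
      LinearMap.mulRight K (tailProd u a i)

theorem insertOp_monomial (i : ℕ) (y : UniversalEnvelopingAlgebra K g) (a : Fin n →₀ ℕ) :
    insertOp u ψ i y (MvPolynomial.monomial a 1) = ψ (headProd u a i * y * tailProd u a i) := by
  have := (MvPolynomial.basisMonomials (Fin n) K).constr_basis K
    (fun a => ψ (headProd u a i * (y * tailProd u a i))) a
  rw [MvPolynomial.coe_basisMonomials] at this
  rw [mul_assoc]
  exact this

/-- Inserting `u i` next to its own power merely raises that exponent: the operator is
multiplication by `x_i`. -/
theorem insertOp_self_mem {u : Fin n → g}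
    {ψ : UniversalEnvelopingAlgebra K g →ₗ[K] MvPolynomial (Fin n) K}
    (hψ : ∀ a, ψ (pbwMonomial u a) = MvPolynomial.monomial a 1)
    (i : Fin n) :
    insertOp u ψ i (UniversalEnvelopingAlgebra.ι K (u i)) ∈ (WeylAlgebra.action K n).range := by
  refine ⟨WeylAlgebra.x K i, ?_⟩
  refine (WeylAlgebra.action_x K i).trans ?_
  refine MvPolynomial.linearMap_ext_monomial fun a => ?_
  rw [insertOp_monomial, LinearMap.mulLeft_apply, MvPolynomial.X,
    MvPolynomial.monomial_mul, one_mul, add_comm, ← hψ, ← headProd_mul_tailProd u _ i,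
    tailProd_eq, tailProd_eq, mul_assoc, ← mul_assoc (UniversalEnvelopingAlgebra.ι K (u i)),
    ← pow_succ', Finsupp.add_apply, Finsupp.single_eq_same]
  rw [headProd_congr u (a := a + Finsupp.single i 1) (b := a), tailProd_congr u
    (a := a + Finsupp.single i 1) (b := a)]
  · intro j hj
    have : i ≠ j := by rintro rfl; omega
    simp [this]
  · intro j hj
    have : i ≠ j := by rintro rfl; omega
    simp [this]

end Operators

section Membership

variable {K g : Type*} [Field K] [CharZero K] [LieRing g] [LieAlgebra K g] {n : ℕ}

/-- `T = ∑_{k < N} (1/k!) F_k ∂_i^k`, as `∂_i^k x^a` has coefficient `k! * choose (a i) k`. The two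
ranges of summation agree: `choose` vanishes for `k > a i`, and `F k` for `k ≥ N`. -/
theorem mem_range_action_of_eq_sum {T : Module.End K (MvPolynomial (Fin n) K)} (i : Fin n)
    {F : ℕ → Module.End K (MvPolynomial (Fin n) K)} (hF : ∀ k, F k ∈ (WeylAlgebra.action K n).range)
    {N : ℕ} (hN : ∀ k, N ≤ k → F k = 0)
    (hT : ∀ a, T (MvPolynomial.monomial a 1) = ∑ k ∈ Finset.range (a i + 1),
      ((a i).choose k : K) • F k (MvPolynomial.monomial (a - Finsupp.single i k) 1)) :
    T ∈ (WeylAlgebra.action K n).range := by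
  have h : T = ∑ k ∈ Finset.range N, (k.factorial : K)⁻¹ •
      (F k * (MvPolynomial.pderiv i).toLinearMap ^ k) := by
    refine MvPolynomial.linearMap_ext_monomial fun a => ?_
    rw [hT, LinearMap.sum_apply]
    have hG (k : ℕ) : ((k.factorial : K)⁻¹ • (F k * (MvPolynomial.pderiv i).toLinearMap ^ k) :
        Module.End K (MvPolynomial (Fin n) K)) (MvPolynomial.monomial a 1) =
        ((a i).choose k : K) • F k (MvPolynomial.monomial (a - Finsupp.single i k) 1) := by
      rw [LinearMap.smul_apply, Module.End.mul_apply, MvPolynomial.pderiv_pow_monomial, map_smul,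
        smul_smul, Nat.descFactorial_eq_factorial_mul_choose, Nat.cast_mul,
        inv_mul_cancel_left₀ (Nat.cast_ne_zero.mpr (Nat.factorial_ne_zero k))]
    simp only [hG]
    rcases le_total (a i + 1) N with hle | hle
    · refine Finset.sum_subset (Finset.range_mono hle) fun k _ hk => ?_
      rw [Finset.mem_range, not_lt] at hk
      rw [Nat.choose_eq_zero_of_lt hk, Nat.cast_zero, zero_smul]
    · refine (Finset.sum_subset (Finset.range_mono hle) fun k _ hk => ?_).symm
      rw [Finset.mem_range, not_lt] at hk
      rw [hN k hk, LinearMap.zero_apply, smul_zero]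
  rw [h]
  refine sum_mem fun k _ => Subalgebra.smul_mem _ (mul_mem (hF k) (pow_mem ?_ k)) _
  exact ⟨WeylAlgebra.d K i, WeylAlgebra.action_d K i⟩

variable {u : Fin n → g} (ψ : UniversalEnvelopingAlgebra K g →ₗ[K] MvPolynomial (Fin n) K)

theorem insertOp_mem_of_succ {i : Fin n} (hi : IsNilpotent (LieAlgebra.ad K g (u i))) {x : g}
    (h : ∀ k, insertOp u ψ (i + 1) (UniversalEnvelopingAlgebra.ι K ((LieAlgebra.ad K g (u i) ^ k) x)) ∈
      (WeylAlgebra.action K n).range) :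
    insertOp u ψ i (UniversalEnvelopingAlgebra.ι K x) ∈ (WeylAlgebra.action K n).range := by
  obtain ⟨N, hN⟩ := isNilpotent_bound (x := x) hi
  refine mem_range_action_of_eq_sum i (N := N) (F := fun k => insertOp u ψ (i + 1)
    (UniversalEnvelopingAlgebra.ι K ((-1 : K) ^ k • (LieAlgebra.ad K g (u i) ^ k) x)))
    (fun k => ?_) (fun k hk => ?_) fun a => ?_
  · rw [map_smul, map_smul]
    exact Subalgebra.smul_mem _ (h k) _
  · simp only [hN k hk, smul_zero, map_zero]
  · rw [insertOp_monomial, tailProd_eq, mul_assoc, ← mul_assoc (UniversalEnvelopingAlgebra.ι K x),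
      ι_mul_ι_pow, Finset.sum_mul, Finset.mul_sum, map_sum]
    refine Finset.sum_congr rfl fun k hk => ?_
    rw [insertOp_monomial, headProd_succ, smul_mul_assoc, mul_smul_comm, map_smul]
    rw [headProd_congr u (a := a - Finsupp.single i k) (b := a), tailProd_congr u
      (a := a - Finsupp.single i k) (b := a)]
    · simp [mul_assoc, -ι_apply]
    · intro j hj
      have : i ≠ j := by rintro rfl; omega
      simp [this]
    · intro j hj
      have : i ≠ j := by rintro rfl; omega
      simp [this]

theorem insertOp_succ_mem {i : Fin n} (hi : IsNilpotent (LieAlgebra.ad K g (u i))) {x : g}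
    (h : ∀ k, insertOp u ψ i (UniversalEnvelopingAlgebra.ι K ((LieAlgebra.ad K g (u i) ^ k) x)) ∈
      (WeylAlgebra.action K n).range) :
    insertOp u ψ (i + 1) (UniversalEnvelopingAlgebra.ι K x) ∈ (WeylAlgebra.action K n).range := by
  obtain ⟨N, hN⟩ := isNilpotent_bound (x := x) hi
  refine mem_range_action_of_eq_sum i (N := N) (F := fun k => insertOp u ψ i
    (UniversalEnvelopingAlgebra.ι K ((LieAlgebra.ad K g (u i) ^ k) x)))
    h (fun k hk => by simp only [hN k hk, map_zero]) fun a => ?_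
  rw [insertOp_monomial, headProd_succ, mul_assoc (headProd u a i), ι_pow_mul_ι, Finset.mul_sum,
    Finset.sum_mul, map_sum]
  refine Finset.sum_congr rfl fun k hk => ?_
  rw [insertOp_monomial, tailProd_eq, mul_smul_comm, smul_mul_assoc, map_smul]
  rw [headProd_congr u (a := a - Finsupp.single i k) (b := a), tailProd_congr u
    (a := a - Finsupp.single i k) (b := a)]
  · simp [mul_assoc, -ι_apply]
  · intro j hj
    have : i ≠ j := by rintro rfl; omega
    simp [this]
  · intro j hj
    have : i ≠ j := by rintro rfl; omega
    simp [this]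

variable {ψ}

/-- Inserting elements of the span of a nilpotent family of generators yields differential
operators. -/
theorem insertOp_generator_mem (hψ : ∀ a, ψ (pbwMonomial u a) = MvPolynomial.monomial a 1)
    (hnil : ∀ i, IsNilpotent (LieAlgebra.ad K g (u i))) {ht : Fin n → ℕ}
    (hbr : ∀ i j, ⁅u i, u j⁆ ∈ Submodule.span K (u '' {k | ht j < ht k})) (j : Fin n) (i : ℕ)
    (hi : i ≤ n) :
    insertOp u ψ i (UniversalEnvelopingAlgebra.ι K (u j)) ∈ (WeylAlgebra.action K n).range := by
  -- Descending induction on height: `d` bounds the distance to one more than the maximal height, so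
  -- `d = 0` is vacuous.
  suffices h : ∀ d j, Finset.univ.sup ht + 1 ≤ ht j + d → ∀ i ≤ n,
      insertOp u ψ i (UniversalEnvelopingAlgebra.ι K (u j)) ∈ (WeylAlgebra.action K n).range from
    h _ j (Nat.le_add_left _ _) i hi
  intro d
  induction d with
  | zero =>
    intro j hj
    have := Finset.le_sup (f := ht) (Finset.mem_univ j)
    omega
  | succ d ih =>
    intro j hj
    have hspan (i : ℕ) (hi : i ≤ n) (y : g) (hy : y ∈ Submodule.span K (u '' {k | ht j < ht k})) :
        insertOp u ψ i (UniversalEnvelopingAlgebra.ι K y) ∈ (WeylAlgebra.action K n).range := by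
      induction hy using Submodule.span_induction with
      | mem y hy =>
        obtain ⟨k, hk, rfl⟩ := hy
        rw [Set.mem_ofPred_eq] at hk
        exact ih k (by omega) i hi
      | zero => rw [map_zero, map_zero]; exact zero_mem _
      | add a b _ _ ha hb => rw [map_add, map_add]; exact add_mem ha hb
      | smul c a _ ha => rw [map_smul, map_smul]; exact Subalgebra.smul_mem _ ha _
    have had (l : Fin n) (k : ℕ) := ad_pow_succ_mem_span hbr l j k
    have hself := insertOp_self_mem hψ j
    -- Crossing one factor changes the operator by terms with at least one bracket, which are
    -- handled by `hspan`. All positions are therefore equivalent, and position `j` is known.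
    have hstep (i : ℕ) (hi : i < n) :
        insertOp u ψ i (UniversalEnvelopingAlgebra.ι K (u j)) ∈ (WeylAlgebra.action K n).range ↔
        insertOp u ψ (i + 1) (UniversalEnvelopingAlgebra.ι K (u j)) ∈
          (WeylAlgebra.action K n).range := by
      constructor
      · intro h
        refine insertOp_succ_mem ψ (i := ⟨i, hi⟩) (hnil _) fun k => ?_
        cases k with
        | zero => exact h
        | succ k => exact hspan i hi.le _ (had _ k)
      · intro h
        refine insertOp_mem_of_succ ψ (i := ⟨i, hi⟩) (hnil _) fun k => ?_
        cases k with
        | zero => exact h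
        | succ k => exact hspan (i + 1) hi _ (had _ k)
    intro i hi
    have hall : ∀ i, i ≤ n → (insertOp u ψ i (UniversalEnvelopingAlgebra.ι K (u j)) ∈
        (WeylAlgebra.action K n).range ↔ insertOp u ψ 0 (UniversalEnvelopingAlgebra.ι K (u j)) ∈
          (WeylAlgebra.action K n).range) := by
      intro i
      induction i with
      | zero => simp
      | succ i ihi => intro hi; rw [← hstep i hi, ihi (Nat.le_of_succ_le hi)]
    rw [hall i hi, ← hall j j.2.le]
    exact hself

/-- The left action of an element of `g` on monomials is by a differential operator. -/
theorem insertOp_zero_mem (hψ : ∀ a, ψ (pbwMonomial u a) = MvPolynomial.monomial a 1)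
    (hnil : ∀ i, IsNilpotent (LieAlgebra.ad K g (u i))) {ht : Fin n → ℕ}
    (hbr : ∀ i j, ⁅u i, u j⁆ ∈ Submodule.span K (u '' {k | ht j < ht k})) {p : Submodule K g}
    (hp : ∀ w, ∀ x ∈ p, ψ (w * UniversalEnvelopingAlgebra.ι K x) = 0)
    (hup : Submodule.span K (Set.range u) ⊔ p = ⊤) (x : g) :
    insertOp u ψ 0 (UniversalEnvelopingAlgebra.ι K x) ∈ (WeylAlgebra.action K n).range := by
  suffices h : ∀ i, i ≤ n → ∀ x, insertOp u ψ i (UniversalEnvelopingAlgebra.ι K x) ∈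
      (WeylAlgebra.action K n).range from h 0 (Nat.zero_le _) x
  intro i hi
  induction hi using Nat.decreasingInduction with
  | of_succ i hi ih => exact fun x => insertOp_mem_of_succ ψ (i := ⟨i, hi⟩) (hnil _) fun k => ih _
  | self =>
    intro x
    obtain ⟨y, hy, z, hz, rfl⟩ := Submodule.mem_sup.mp (hup ▸ Submodule.mem_top : x ∈ _ ⊔ p)
    rw [map_add, map_add]
    refine add_mem ?_ ?_
    · induction hy using Submodule.span_induction with
      | mem y hy =>
        obtain ⟨j, rfl⟩ := hy
        exact insertOp_generator_mem hψ hnil hbr j n le_rfl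
      | zero => rw [map_zero, map_zero]; exact zero_mem _
      | add a b _ _ ha hb => rw [map_add, map_add]; exact add_mem ha hb
      | smul c a _ ha => rw [map_smul, map_smul]; exact Subalgebra.smul_mem _ ha _
    · have : insertOp u ψ n (UniversalEnvelopingAlgebra.ι K z) = 0 := by
        refine MvPolynomial.linearMap_ext_monomial fun a => ?_
        rw [insertOp_monomial, tailProd_last, mul_one, hp _ _ hz,
          LinearMap.zero_apply]
      rw [this]
      exact zero_mem _

end Membership

section Main

variable {K g : Type*} [Field K] [CharZero K] [LieRing g] [LieAlgebra K g] {p : LieSubalgebra K g}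
  {n : ℕ} {u : Fin n → g} {φ : GenVerma₀ p ≃ₗ[K] MvPolynomial (Fin n) K}

/-- Operators in the image of the Weyl algebra are closed under composition, so elements of `g`
suffice; these act by insertion at position `0`. -/
theorem conj_lsmul_mem (hφ : ∀ a, φ (genVermaTmul p (pbwMonomial u a)) = MvPolynomial.monomial a 1)
    (hnil : ∀ i, IsNilpotent (LieAlgebra.ad K g (u i))) {ht : Fin n → ℕ}
    (hbr : ∀ i j, ⁅u i, u j⁆ ∈ Submodule.span K (u '' {k | ht j < ht k}))
    (hup : Submodule.span K (Set.range u) ⊔ p.toSubmodule = ⊤)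
    (w : UniversalEnvelopingAlgebra K g) :
    φ.conj (Algebra.lsmul K K (GenVerma₀ p) w) ∈ (WeylAlgebra.action K n).range := by
  induction w using adjoin_induction_left with
  | one =>
    rw [map_one, Module.End.one_eq_id, LinearEquiv.conj_id]
    exact one_mem _
  | mul x w hw =>
    rw [map_mul, Module.End.mul_eq_comp, LinearEquiv.conj_comp]
    refine mul_mem ?_ hw
    have h := insertOp_zero_mem (ψ := φ.toLinearMap ∘ₗ genVermaTmulₗ p) (fun a => hφ a) hnil hbr
      (p := p.toSubmodule) (fun w x hx => ?_) hup x
    · convert h using 1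
      refine MvPolynomial.linearMap_ext_monomial fun a => ?_
      rw [insertOp_monomial, headProd_zero, one_mul,
        tailProd_zero, LinearEquiv.conj_apply_apply, ← hφ, LinearEquiv.symm_apply_apply]
      change _ = φ (genVermaTmul p _)
      rw [genVermaTmul_mul]
      rfl
    · change φ (genVermaTmul p _) = 0
      rw [← uMap_ι p ⟨x, hx⟩, genVermaTmul_mul_uMap, augmentation_ι, zero_smul, map_zero]
  | add a b ha hb => rw [map_add, map_add]; exact add_mem ha hb
  | smul c a ha => rw [map_smul, map_smul]; exact Subalgebra.smul_mem _ ha _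

theorem exists_diagramCommutes
    (h : ∀ w : UniversalEnvelopingAlgebra K g, φ.conj (Algebra.lsmul K K (GenVerma₀ p) w) ∈ (WeylAlgebra.action K n).range) :
    ∃ Φ : UniversalEnvelopingAlgebra K g →ₗ[K] WeylAlgebra K n, DiagramCommutes φ Φ := by
  let A : UniversalEnvelopingAlgebra K g →ₐ[K] Module.End K (GenVerma₀ p) := Algebra.lsmul K K _
  obtain ⟨θ, hθ⟩ := LinearMap.exists_leftInverse_of_injective (WeylAlgebra.action K n).toLinearMap
    (LinearMap.ker_eq_bot.mpr WeylAlgebra.action_injective)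
  refine ⟨θ ∘ₗ φ.conj.toLinearMap ∘ₗ A.toLinearMap, fun w => ?_⟩
  obtain ⟨y, hy⟩ := h w
  change φ.conj (A w) = WeylAlgebra.action K n (θ (φ.conj (A w)))
  change WeylAlgebra.action K n y = φ.conj (A w) at hy
  rw [← hy]
  exact congrArg _ (DFunLike.congr_fun hθ y).symm

theorem DiagramCommutes.map_commutator
    {Φ : UniversalEnvelopingAlgebra K g →ₗ[K] WeylAlgebra K n} (h : DiagramCommutes φ Φ)
    (a c : UniversalEnvelopingAlgebra K g) : Φ (a * c - c * a) = Φ a * Φ c - Φ c * Φ a := by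
  apply WeylAlgebra.action_injective
  rw [map_sub (WeylAlgebra.action K n), map_mul (WeylAlgebra.action K n),
    map_mul (WeylAlgebra.action K n), ← h, ← h, ← h, map_sub, map_sub,
    map_mul (Algebra.lsmul K K _), map_mul (Algebra.lsmul K K _), Module.End.mul_eq_comp,
    Module.End.mul_eq_comp, LinearEquiv.conj_comp, LinearEquiv.conj_comp]
  rfl

end Main

end InducedModules

/-! ### Root spaces and the nilradical of a parabolic subalgebra -/

section RootSpaces

open LieAlgebra LieModule LieAlgebra.IsKilling

section WeightSup

variable {K g : Type*} [Field K] [LieRing g] [LieAlgebra K g]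
  (H : LieSubalgebra K g) [LieRing.IsNilpotent H]

/-- The sum of the root spaces of the weights in a set. -/
def weightSup (S : Set (Weight K H g)) : Submodule K g :=
  ⨆ χ ∈ S, (rootSpace H (χ : H → K)).toSubmodule

variable {H}

theorem rootSpace_le_weightSup {S : Set (Weight K H g)} {χ : Weight K H g} (h : χ ∈ S) :
    (rootSpace H (χ : H → K)).toSubmodule ≤ weightSup H S :=
  le_biSup (fun χ : Weight K H g => (rootSpace H (χ : H → K)).toSubmodule) h

theorem weightSup_le {S : Set (Weight K H g)} {V : Submodule K g} :
    weightSup H S ≤ V ↔ ∀ χ ∈ S, (rootSpace H (χ : H → K)).toSubmodule ≤ V :=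
  iSup₂_le_iff

theorem weightSup_mono {S T : Set (Weight K H g)} (h : S ⊆ T) : weightSup H S ≤ weightSup H T :=
  weightSup_le.mpr fun _ hχ => rootSpace_le_weightSup (h hχ)

theorem weightSup_sup (S T : Set (Weight K H g)) :
    weightSup H S ⊔ weightSup H T = weightSup H (S ∪ T) :=
  iSup_union.symm

theorem disjoint_weightSup [Module.IsTorsionFree K g] {S T : Set (Weight K H g)}
    (h : Disjoint S T) : Disjoint (weightSup H S) (weightSup H T) :=
  (LieSubmodule.iSupIndep_toSubmodule.mpr (iSupIndep_genWeightSpace' K H g)).disjoint_biSup_biSup h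

/-- The bracket of sums of root spaces lies in the sum of the root spaces of the sums of roots. -/
theorem lie_mem_weightSup {S T R : Set (Weight K H g)}
    (h : ∀ α ∈ S, ∀ β ∈ T, ∀ γ : Weight K H g, (γ : H → K) = α + β → γ ∈ R) {x y : g}
    (hx : x ∈ weightSup H S) (hy : y ∈ weightSup H T) : ⁅x, y⁆ ∈ weightSup H R := by
  have key (α) (hα : α ∈ S) (x : g) (hx : x ∈ rootSpace H (α : H → K)) :
      weightSup H T ≤ (weightSup H R).comap (ad K g x : g →ₗ[K] g) := by
    refine weightSup_le.mpr fun β hβ y hy => ?_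
    rw [Submodule.mem_comap, ad_apply]
    have hxy : ⁅x, y⁆ ∈ rootSpace H ((α : H → K) + β) :=
      lie_mem_genWeightSpace_of_mem_genWeightSpace hx hy
    -- If `α + β` is not a weight, the bracket is zero.
    by_cases hne : rootSpace H ((α : H → K) + β) = ⊥
    · rw [hne, LieSubmodule.mem_bot] at hxy
      rw [hxy]
      exact zero_mem _
    · exact rootSpace_le_weightSup (h α hα β hβ ⟨_, hne⟩ rfl) hxy
  have key' : weightSup H S ≤ (weightSup H R).comap (ad K g y : g →ₗ[K] g) := by
    refine weightSup_le.mpr fun α hα x hx => ?_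
    rw [Submodule.mem_comap, ad_apply, ← lie_skew]
    exact neg_mem (key α hα x hx hy)
  have := key' hx
  rw [Submodule.mem_comap, ad_apply, ← lie_skew] at this
  simpa using neg_mem this

theorem eq_iSup_inf_rootSpace [FiniteDimensional K g] [IsTriangularizable K H g]
    (V : Submodule K g) (hV : ∀ h ∈ H, ∀ v ∈ V, ⁅h, v⁆ ∈ V) :
    V = ⨆ χ : Weight K H g, V ⊓ (rootSpace H (χ : H → K)).toSubmodule := by
  let N : LieSubmodule K H g := { V with lie_mem := fun {x m} hm => hV x x.2 m hm }
  have h := congrArg LieSubmodule.toSubmodule (eq_iSup_inf_genWeightSpace K H g N)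
  simpa only [LieSubmodule.iSup_toSubmodule, LieSubmodule.inf_toSubmodule] using h

theorem weightSup_univ [FiniteDimensional K g] [IsTriangularizable K H g] :
    weightSup H Set.univ = ⊤ := by
  rw [eq_top_iff, eq_iSup_inf_rootSpace (H := H) ⊤ fun _ _ _ _ => Submodule.mem_top]
  exact iSup_le fun χ => inf_le_right.trans (rootSpace_le_weightSup (Set.mem_univ χ))

end WeightSup

section Killing

variable {K g : Type*} [Field K] [LieRing g] [LieAlgebra K g]
  [IsKilling K g] [FiniteDimensional K g]
  {H : LieSubalgebra K g} [H.IsCartanSubalgebra] [IsTriangularizable K H g]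

/-- An additive height on weights such that the subalgebra `p` contains `H` and all root spaces of
non-negative height. -/
structure IsParabolicHeight (H : LieSubalgebra K g) [H.IsCartanSubalgebra]
    [IsTriangularizable K H g] (p : LieSubalgebra K g)
    (ht : Weight K H g → ℤ) : Prop where
  neg (α : Weight K H g) : ht (-α) = -ht α
  add (α β γ : Weight K H g) : (γ : H → K) = α + β → ht γ = ht α + ht β
  le (α : Weight K H g) : 0 ≤ ht α → (rootSpace H (α : H → K)).toSubmodule ≤ p.toSubmodule
  cartan_le : H ≤ p

namespace IsParabolicHeight

variable {p : LieSubalgebra K g} {ht : Weight K H g → ℤ}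

theorem neg_of_not_le (hh : IsParabolicHeight H p ht) {χ : Weight K H g}
    (h : ¬ (rootSpace H (χ : H → K)).toSubmodule ≤ p.toSubmodule) : ht χ < 0 :=
  not_le.mp fun h' => h (hh.le χ h')

theorem rootSpace_neg_le (hh : IsParabolicHeight H p ht) {χ : Weight K H g}
    (h : ¬ (rootSpace H (χ : H → K)).toSubmodule ≤ p.toSubmodule) :
    (rootSpace H ((-χ : Weight K H g) : H → K)).toSubmodule ≤ p.toSubmodule :=
  hh.le _ (by rw [hh.neg]; have := hh.neg_of_not_le h; omega)

theorem isNonZero_of_not_le (hh : IsParabolicHeight H p ht) {χ : Weight K H g}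
    (h : ¬ (rootSpace H (χ : H → K)).toSubmodule ≤ p.toSubmodule) : χ.IsNonZero := by
  intro h0
  refine h ?_
  rw [h0.eq, rootSpace_zero_eq]
  exact hh.cartan_le

end IsParabolicHeight

variable [CharZero K]

/-- Root spaces of nonzero roots are one-dimensional. -/
theorem rootSpace_le_of_mem {α : Weight K H g} (hα : α.IsNonZero) {x : g}
    (hx : x ∈ rootSpace H (α : H → K)) (hx0 : x ≠ 0) {V : Submodule K g} (hV : x ∈ V) :
    (rootSpace H (α : H → K)).toSubmodule ≤ V := by
  intro y hy
  obtain ⟨c, hc⟩ := (finrank_eq_one_iff_of_nonzero' (⟨x, hx⟩ : rootSpace H (α : H → K))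
    (by simpa using! hx0)).mp (finrank_rootSpace_eq_one α hα) ⟨y, hy⟩
  have : c • x = y := congrArg Subtype.val hc
  rw [← this]
  exact V.smul_mem c hV

theorem inf_rootSpace_eq_bot {α : Weight K H g} (hα : α.IsNonZero) {V : Submodule K g}
    (hV : ¬ (rootSpace H (α : H → K)).toSubmodule ≤ V) :
    V ⊓ (rootSpace H (α : H → K)).toSubmodule = ⊥ := by
  rw [eq_bot_iff]
  rintro x ⟨hxV, hx⟩
  by_contra hx0
  exact hV (rootSpace_le_of_mem hα hx hx0 hxV)

/-- If `α`, `β` and `α + β` are roots, then `[g^α, g^β] = g^(α + β)`. -/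
theorem rootSpace_add_le {α β γ : Weight K H g} (hα : α.IsNonZero) (hγ : γ.IsNonZero)
    (h : (γ : H → K) = α + β) {V : LieSubalgebra K g}
    (hαV : (rootSpace H (α : H → K)).toSubmodule ≤ V.toSubmodule)
    (hβV : (rootSpace H (β : H → K)).toSubmodule ≤ V.toSubmodule) :
    (rootSpace H (γ : H → K)).toSubmodule ≤ V.toSubmodule := by
  have hne : rootSpace H ((1 : ℤ) • (α : H → K) + β) ≠ ⊥ := by
    rw [one_smul, ← h]
    exact γ.genWeightSpace_ne_bot
  -- Start from the top `x` of the `α`-string through `β`. Then `f^(k+1) x` has weight `β`, and `e`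
  -- sends it to `(k+1)(chainLength - k) f^k x`, a nonzero vector of weight `γ`.
  obtain ⟨k, hk⟩ : ∃ k, chainTopCoeff α β = k + 1 :=
    Nat.exists_eq_add_one.mpr
      (by exact_mod_cast ((rootSpace_zsmul_add_ne_bot_iff α β hα 1).mp hne).1)
  obtain ⟨x, hx, x_ne0⟩ := (chainTop α β).exists_ne_zero
  obtain ⟨c, e, f, isSl2, he, hf⟩ := exists_isSl2Triple_of_weight_isNonZero hα
  obtain rfl := isSl2.h_eq_coroot hα he hf
  have prim : isSl2.HasPrimitiveVectorWith x (chainLength α β : K) :=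
    have := lie_mem_genWeightSpace_of_mem_genWeightSpace he hx
    ⟨x_ne0, (chainLength_smul _ _ hx).symm, by rwa [genWeightSpace_add_chainTop _ _ hα] at this⟩
  have hle : k + 1 ≤ chainLength α β := hk ▸ chainTopCoeff_le_chainLength α β
  have h1 := toEnd_pow_apply_mem hf hx (k + 1)
  have h0 := toEnd_pow_apply_mem hf hx k
  have hne0 := prim.pow_toEnd_f_ne_zero_of_eq_nat rfl (Nat.le_of_succ_le hle)
  have hlie := prim.lie_e_pow_succ_toEnd_f k
  rw [coe_chainTop', hk] at h1 h0
  have e1 : (k + 1) • (-(α : H → K)) + ((k + 1) • (α : H → K) + β) = β := by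
    rw [smul_neg, neg_add_cancel_left]
  have e0 : k • (-(α : H → K)) + ((k + 1) • (α : H → K) + β) = γ := by
    rw [smul_neg, succ_nsmul, add_assoc, neg_add_cancel_left, h]
  rw [e1] at h1
  rw [e0] at h0
  refine rootSpace_le_of_mem hγ h0 hne0 ?_
  have hmem : ⁅e, ((toEnd K g g f) ^ (k + 1)) x⁆ ∈ V.toSubmodule :=
    V.lie_mem (hαV he) (hβV h1)
  rw [hlie] at hmem
  refine (V.toSubmodule.smul_mem_iff (mul_ne_zero ?_ ?_)).mp hmem
  · exact_mod_cast Nat.succ_ne_zero k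
  · rw [sub_ne_zero]
    exact_mod_cast (Nat.lt_of_succ_le hle).ne'

namespace IsParabolicHeight

variable {p : LieSubalgebra K g} {ht : Weight K H g → ℤ}

/-- Since `-α = -δ + γ`, having both `g^(-δ)` and `g^γ` in `p` would put `g^(-α)` in `p`. This
closure property makes `nilIdeal` an ideal and `n₋` a subalgebra. -/
theorem not_le_add (hh : IsParabolicHeight H p ht) {α γ δ : Weight K H g}
    (hα : ¬ (rootSpace H ((-α : Weight K H g) : H → K)).toSubmodule ≤ p.toSubmodule)
    (hγ : (rootSpace H (γ : H → K)).toSubmodule ≤ p.toSubmodule)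
    (h : (δ : H → K) = γ + α) :
    ¬ (rootSpace H ((-δ : Weight K H g) : H → K)).toSubmodule ≤ p.toSubmodule := by
  intro hδ
  by_cases h0 : δ.IsZero
  · have : -α = γ := by
      ext x
      have := congrFun h x
      rw [h0.eq] at this
      exact neg_eq_of_add_eq_zero_left this.symm
    exact hα (this ▸ hγ)
  · exact hα (rootSpace_add_le (α := -δ) (β := γ) (Weight.IsNonZero.neg h0)
      (hh.isNonZero_of_not_le hα) (by simp [h]) hδ hγ)

theorem toSubmodule_eq_weightSup (hh : IsParabolicHeight H p ht) : p.toSubmodule =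
    weightSup H {χ | (rootSpace H (χ : H → K)).toSubmodule ≤ p.toSubmodule} := by
  refine le_antisymm ?_ (weightSup_le.mpr fun χ hχ => hχ)
  refine (eq_iSup_inf_rootSpace (H := H) p.toSubmodule fun h hh' v hv =>
    p.lie_mem (hh.cartan_le hh') hv).le.trans ?_
  refine iSup_le fun χ => ?_
  by_cases hχ : (rootSpace H (χ : H → K)).toSubmodule ≤ p.toSubmodule
  · exact inf_le_right.trans (rootSpace_le_weightSup hχ)
  · rw [inf_rootSpace_eq_bot (hh.isNonZero_of_not_le hχ) hχ]
    exact bot_le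

theorem isCompl_weightSup (hh : IsParabolicHeight H p ht) :
    IsCompl (weightSup H {χ | ¬ (rootSpace H (χ : H → K)).toSubmodule ≤ p.toSubmodule})
      p.toSubmodule := by
  have h := hh.toSubmodule_eq_weightSup
  set S : Set (Weight K H g) := {χ | (rootSpace H (χ : H → K)).toSubmodule ≤ p.toSubmodule} with hS
  change IsCompl (weightSup H Sᶜ) _
  rw [h]
  exact ⟨disjoint_weightSup disjoint_compl_left,
    codisjoint_iff.mpr (by rw [weightSup_sup, Set.compl_union_self, weightSup_univ])⟩

/-- The sum of the root spaces `g^α ⊆ p` with `g^(-α) ⊄ p`, as an ideal of `p`. -/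
def nilIdeal (hh : IsParabolicHeight H p ht) : LieIdeal K p :=
  { (weightSup H {α | ¬ (rootSpace H ((-α : Weight K H g) : H → K)).toSubmodule ≤
      p.toSubmodule}).comap p.toSubmodule.subtype with
    lie_mem := fun {x y} hy => by
      have hx := x.2
      rw [← LieSubalgebra.mem_toSubmodule, hh.toSubmodule_eq_weightSup] at hx
      exact lie_mem_weightSup (fun γ hγ α hα δ hδ => hh.not_le_add hα hγ hδ) hx hy }

theorem mem_nilIdeal (hh : IsParabolicHeight H p ht) {x : p} : x ∈ hh.nilIdeal ↔ (x : g) ∈ weightSup H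
    {α | ¬ (rootSpace H ((-α : Weight K H g) : H → K)).toSubmodule ≤ p.toSubmodule} := Iff.rfl

/-- All its weights have positive height, so each `ad x` raises height and is nilpotent; Engel's
theorem concludes. -/
theorem isNilpotent_nilIdeal (hh : IsParabolicHeight H p ht) : LieRing.IsNilpotent hh.nilIdeal := by
  rw [LieAlgebra.isNilpotent_iff_forall (R := K)]
  intro x
  obtain ⟨M, hM⟩ : ∃ M : ℕ, ∀ χ, ht χ < M := by
    obtain ⟨M, hM⟩ := (Set.finite_range ht).bddAbove
    exact ⟨(M + 1).toNat, fun χ => by have := hM ⟨χ, rfl⟩; omega⟩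
  have hpos : weightSup H {α | ¬ (rootSpace H ((-α : Weight K H g) : H → K)).toSubmodule ≤
      p.toSubmodule} ≤ weightSup H {α | 1 ≤ ht α} := weightSup_mono fun α hα => by
    have := hh.neg_of_not_le hα
    rw [hh.neg] at this
    change 1 ≤ ht α
    omega
  have hpow (k : ℕ) (y : hh.nilIdeal) :
      (((ad K hh.nilIdeal x ^ k) y : hh.nilIdeal) : g) ∈
        weightSup H {α | (k : ℤ) + 1 ≤ ht α} := by
    induction k with
    | zero => simpa using hpos (hh.mem_nilIdeal.mp y.2)
    | succ k ih =>
      rw [pow_succ', Module.End.mul_apply, ad_apply]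
      refine lie_mem_weightSup (fun α hα β hβ γ hγ => ?_) (hpos (hh.mem_nilIdeal.mp x.2)) ih
      have := hh.add α β γ hγ
      change 1 ≤ ht α at hα
      change (k : ℤ) + 1 ≤ ht β at hβ
      change ((k + 1 : ℕ) : ℤ) + 1 ≤ ht γ
      push_cast
      omega
  refine ⟨M, LinearMap.ext fun y => ?_⟩
  have h := hpow M y
  have hempty : {α | (M : ℤ) + 1 ≤ ht α} = ∅ := by
    ext α
    have := hM α
    simp only [Set.mem_ofPred_eq, Set.mem_empty_iff_false, iff_false]
    omega
  rw [hempty] at h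
  have h0 : weightSup H (∅ : Set (Weight K H g)) = ⊥ := by simp [weightSup]
  rw [h0, Submodule.mem_bot] at h
  exact Subtype.ext (Subtype.ext h)

theorem le_nilradicalIn (hh : IsParabolicHeight H p ht) {α : Weight K H g}
    (hα : ¬ (rootSpace H ((-α : Weight K H g) : H → K)).toSubmodule ≤ p.toSubmodule) :
    (rootSpace H (α : H → K)).toSubmodule ≤ nilradicalIn p := by
  intro x hx
  have hxp : x ∈ p := by
    have := hh.rootSpace_neg_le hα
    rw [neg_neg] at this
    exact this hx
  have h1 : hh.nilIdeal ≤ sSup {I : LieIdeal K p | LieRing.IsNilpotent I} :=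
    le_sSup hh.isNilpotent_nilIdeal
  exact ⟨⟨x, hxp⟩, h1 (hh.mem_nilIdeal.mpr (rootSpace_le_weightSup (S :=
    {α : Weight K H g | ¬ (rootSpace H ((-α : Weight K H g) : H → K)).toSubmodule ≤ p.toSubmodule})
      hα hx)), rfl⟩

/-- Suppose `g^(-α) ⊆ p`. A nilpotent ideal containing `g^α` would contain `e` and `h = [e, f]`, but
`[h, e] = 2e` contradicts nilpotency of `ad h`. So every nilpotent ideal lies in the sum of the
weight spaces other than `g^α`, and hence so does their sum; nilpotency of that sum is not needed.
-/
theorem not_le_of_le_nilradicalIn (hh : IsParabolicHeight H p ht) {α : Weight K H g} (hα : α.IsNonZero)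
    (h : (rootSpace H (α : H → K)).toSubmodule ≤ nilradicalIn p) :
    ¬ (rootSpace H ((-α : Weight K H g) : H → K)).toSubmodule ≤ p.toSubmodule := by
  intro hneg
  have key : nilradicalIn p ≤ weightSup H {α}ᶜ := by
    rw [nilradicalIn, Submodule.map_le_iff_le_comap, LieSubmodule.sSup_toSubmodule_eq_iSup]
    refine iSup₂_le fun I hI => ?_
    rw [← Submodule.map_le_iff_le_comap]
    refine (eq_iSup_inf_rootSpace (H := H) _ ?_).le.trans (iSup_le fun χ => ?_)
    · rintro h hH _ ⟨v, hv, rfl⟩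
      exact ⟨⁅(⟨h, hh.cartan_le hH⟩ : p), v⁆, I.lie_mem hv, rfl⟩
    · by_cases hχ : χ = α
      · subst hχ
        rw [inf_rootSpace_eq_bot hα]
        · exact bot_le
        intro hle
        obtain ⟨c, e, f, isSl2, he, hf⟩ := exists_isSl2Triple_of_weight_isNonZero hα
        obtain ⟨e, heI, rfl⟩ := hle he
        have hfp : f ∈ p := hneg hf
        have hcI : ⁅e, (⟨f, hfp⟩ : p)⁆ ∈ I := lie_mem_left K p I _ _ heI
        have hnil := (LieAlgebra.isNilpotent_iff_forall (R := K)).mp hI ⟨_, hcI⟩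
        obtain ⟨k, hk⟩ := hnil
        have hlie : ⁅(⟨_, hcI⟩ : I), (⟨e, heI⟩ : I)⁆ = (2 : K) • (⟨e, heI⟩ : I) := by
          refine Subtype.ext (Subtype.ext ?_)
          change ⁅⁅(e : g), f⁆, (e : g)⁆ = (2 : K) • (e : g)
          have h1 := isSl2.lie_e_f
          have h2 := isSl2.lie_h_e_smul K
          rw [← h1] at h2
          exact h2
        have hpow (k : ℕ) : (ad K I ⟨_, hcI⟩ ^ k) (⟨e, heI⟩ : I) =
            ((2 : K) ^ k) • (⟨e, heI⟩ : I) := by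
          induction k with
          | zero => simp
          | succ k ih =>
            rw [pow_succ', Module.End.mul_apply, ih, map_smul, ad_apply, hlie, smul_smul, pow_succ]
        have h0 := hpow k
        rw [hk, LinearMap.zero_apply, eq_comm, smul_eq_zero] at h0
        rcases h0 with h0 | h0
        · exact pow_ne_zero k two_ne_zero h0
        · exact isSl2.e_ne_zero (congrArg (fun z : I => ((z : p) : g)) h0)
      · exact inf_le_right.trans (rootSpace_le_weightSup hχ)
  have hdis := disjoint_weightSup (K := K) (H := H) (S := {α}) (T := {α}ᶜ) disjoint_compl_right
  obtain ⟨x, hx, hx0⟩ := α.exists_ne_zero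
  exact hx0 (Submodule.disjoint_def.mp hdis x (rootSpace_le_weightSup (Set.mem_singleton α) hx)
    (key (h hx)))

theorem oppositeNilradical_eq (hh : IsParabolicHeight H p ht) : (oppositeNilradical H p).toSubmodule =
    weightSup H {χ | ¬ (rootSpace H (χ : H → K)).toSubmodule ≤ p.toSubmodule} := by
  apply le_antisymm
  · let S : LieSubalgebra K g :=
      { weightSup H {χ | ¬ (rootSpace H (χ : H → K)).toSubmodule ≤ p.toSubmodule} with
        lie_mem' := fun {x y} hx hy => by
          refine lie_mem_weightSup (fun α hα β hβ γ hγ => ?_) hx hy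
          have := hh.not_le_add (α := -α) (γ := -β) (δ := -γ) (by rwa [neg_neg])
            (hh.rootSpace_neg_le hβ) (by simp [hγ])
          rwa [neg_neg] at this }
    change oppositeNilradical H p ≤ S
    refine LieSubalgebra.lieSpan_le.mpr ?_
    rintro x ⟨α, hα, hle, hx⟩
    exact rootSpace_le_weightSup (χ := -α) (hh.not_le_of_le_nilradicalIn hα hle) hx
  · refine weightSup_le.mpr fun χ hχ x hx => LieSubalgebra.subset_lieSpan ⟨-χ, ?_, ?_, ?_⟩
    · exact Weight.IsNonZero.neg (hh.isNonZero_of_not_le hχ)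
    · exact hh.le_nilradicalIn (by rwa [neg_neg])
    · simpa using hx

end IsParabolicHeight

end Killing

theorem exists_root_eq {K g : Type*} [Field K] [LieRing g] [LieAlgebra K g]
    [FiniteDimensional K g] {H : LieSubalgebra K g} [H.IsCartanSubalgebra] {χ : Weight K H g}
    (h : χ.IsNonZero) : ∃ i : H.root, (i : Weight K H g) = χ :=
  ⟨⟨χ, by simpa using h⟩, rfl⟩

/-! ### The height attached to a Borel subalgebra -/

section Borel

variable {K g : Type*} [Field K] [CharZero K] [LieRing g] [LieAlgebra K g]
  [FiniteDimensional K g] [LieAlgebra.IsSemisimple K g]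
  {H : LieSubalgebra K g} [H.IsCartanSubalgebra] [IsTriangularizable K H g]

/-- The height of a weight relative to a base, where the zero weight has height zero. -/
def weightHeight (Δ : (rootSystem H).Base) (χ : Weight K H g) : ℤ :=
  if h : χ.IsNonZero then Δ.height ⟨χ, by simpa using h⟩ else 0

theorem weightHeight_coe (Δ : (rootSystem H).Base) (i : H.root) :
    weightHeight Δ (i : Weight K H g) = Δ.height i := by
  rw [weightHeight, dif_pos (LieSubalgebra.isNonZero_coe_root i)]

theorem weightHeight_of_isZero (Δ : (rootSystem H).Base) {χ : Weight K H g} (h : χ.IsZero) :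
    weightHeight Δ χ = 0 := by
  rw [weightHeight, dif_neg (not_not.mpr h)]

theorem weightHeight_neg (Δ : (rootSystem H).Base) (χ : Weight K H g) :
    weightHeight Δ (-χ) = -weightHeight Δ χ := by
  by_cases h : χ.IsZero
  · rw [weightHeight_of_isZero Δ h, weightHeight_of_isZero Δ h.neg, neg_zero]
  · obtain ⟨i, rfl⟩ := exists_root_eq h
    obtain ⟨j, hj⟩ := exists_root_eq (Weight.IsNonZero.neg h)
    have hji : j = (rootSystem H).reflectionPerm i i := by
      rw [← RootPairing.root_eq_neg_iff, rootSystem_root_apply, rootSystem_root_apply, hj]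
      rfl
    rw [← hj, weightHeight_coe, weightHeight_coe, hji]
    exact Δ.height_reflectionPerm_self i

theorem weightHeight_add (Δ : (rootSystem H).Base) {α β γ : Weight K H g}
    (h : (γ : H → K) = α + β) : weightHeight Δ γ = weightHeight Δ α + weightHeight Δ β := by
  by_cases hα : α.IsZero
  · have : γ = β := by ext x; rw [h, hα.eq, zero_add]
    rw [this, weightHeight_of_isZero Δ hα, zero_add]
  by_cases hβ : β.IsZero
  · have : γ = α := by ext x; rw [h, hβ.eq, add_zero]
    rw [this, weightHeight_of_isZero Δ hβ, add_zero]
  by_cases hγ : γ.IsZero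
  · have : α = -β := by
      ext x
      exact eq_neg_of_add_eq_zero_left ((congrFun h x).symm.trans (congrFun hγ.eq x))
    rw [this, weightHeight_neg, weightHeight_of_isZero Δ hγ, neg_add_cancel]
  obtain ⟨i, rfl⟩ := exists_root_eq hα
  obtain ⟨j, rfl⟩ := exists_root_eq hβ
  obtain ⟨k, rfl⟩ := exists_root_eq hγ
  rw [weightHeight_coe, weightHeight_coe, weightHeight_coe]
  refine Δ.height_add ?_
  ext x
  exact congrFun h x

theorem exists_isParabolicHeight {b p : LieSubalgebra K g} (hb : IsBorelSubalgebra H b)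
    (hbp : b ≤ p) : ∃ ht, IsParabolicHeight H p ht := by
  obtain ⟨Δ, hΔ⟩ := hb
  have hH : H ≤ p := by
    refine le_trans ?_ hbp
    change H.toSubmodule ≤ b.toSubmodule
    rw [hΔ]
    exact le_sup_left
  refine ⟨weightHeight Δ, weightHeight_neg Δ, fun _ _ _ h => weightHeight_add Δ h,
    fun χ hχ => ?_, hH⟩
  by_cases h : χ.IsZero
  · rw [h.eq, rootSpace_zero_eq]
    exact hH
  · obtain ⟨i, rfl⟩ := exists_root_eq h
    rw [weightHeight_coe] at hχ
    refine le_trans ?_ (show b.toSubmodule ≤ p.toSubmodule from hbp)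
    rw [hΔ]
    exact le_sup_of_le_right (le_iSup₂_of_le i (Δ.isPos_iff'.mpr hχ) le_rfl)

end Borel

/-- An element of a root space which is a combination of root vectors is a combination of those of
the same weight. -/
theorem mem_span_of_mem_rootSpace {K g ι : Type*} [Field K] [LieRing g] [LieAlgebra K g] [Fintype ι]
    {H : LieSubalgebra K g} [LieRing.IsNilpotent H] {u : ι → g} {β : ι → Weight K H g}
    (hu : ∀ i, u i ∈ rootSpace H (β i : H → K)) {γ : Weight K H g} {x : g}
    (hx : x ∈ rootSpace H (γ : H → K)) (hxu : x ∈ Submodule.span K (Set.range u)) :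
    x ∈ Submodule.span K (u '' {k | β k = γ}) := by
  classical
  obtain ⟨c, rfl⟩ := (Submodule.mem_span_range_iff_exists_fun K).mp hxu
  rw [← Finset.sum_filter_add_sum_filter_not Finset.univ (fun k => β k = γ)] at hx ⊢
  have h1 : ∑ k with β k = γ, c k • u k ∈ rootSpace H (γ : H → K) :=
    sum_mem fun k hk => (rootSpace H (γ : H → K)).smul_mem _
      ((Finset.mem_filter.mp hk).2 ▸ hu k)
  have h2 : ∑ k with ¬ β k = γ, c k • u k ∈ weightSup H ({γ}ᶜ : Set (Weight K H g)) :=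
    sum_mem fun k hk => Submodule.smul_mem _ _
      (rootSpace_le_weightSup (χ := β k) (Finset.mem_filter.mp hk).2 (hu k))
  have h3 : ∑ k with ¬ β k = γ, c k • u k ∈ rootSpace H (γ : H → K) := by
    simpa using sub_mem hx h1
  have hdis := disjoint_weightSup (K := K) (H := H) (S := {γ}) (T := {γ}ᶜ) disjoint_compl_right
  rw [Submodule.disjoint_def.mp hdis _ (rootSpace_le_weightSup (Set.mem_singleton γ) h3) h2,
    add_zero]
  exact sum_mem fun k hk => Submodule.smul_mem _ _
    (Submodule.subset_span ⟨k, (Finset.mem_filter.mp hk).2, rfl⟩)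

section Adjoint

attribute [local instance] LieRing.ofAssociativeRing

theorem LieAlgebra.ad_injective_of_isSemisimple (K g : Type*) [Field K] [LieRing g]
    [LieAlgebra K g] [LieAlgebra.IsSemisimple K g] : Function.Injective (ad K g) :=
  (ad K g).ker_eq_bot.mp (ad_ker_eq_bot_of_hasTrivialRadical K g)

end Adjoint

end RootSpaces

end

/-! ### The main theorem -/

open LieAlgebra LieModule in
theorem proposition3p5 {K g : Type*} [Field K] [CharZero K] [LieRing g] [LieAlgebra K g]
    [FiniteDimensional K g] [LieAlgebra.IsSemisimple K g]
    (H : LieSubalgebra K g) [H.IsCartanSubalgebra] [LieModule.IsTriangularizable K H g]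
    (b p : LieSubalgebra K g) (hb : IsBorelSubalgebra H b) (hbp : b ≤ p)
    (n : ℕ) (u : Module.Basis (Fin n) K (oppositeNilradical H p))
    (hu : ∀ i, ∃ β : LieModule.Weight K H g, β.IsNonZero ∧ (u i : g) ∈ LieAlgebra.rootSpace H β) :
    ∃ φ : GenVerma₀ p ≃ₗ[K] MvPolynomial (Fin n) K,
      (∀ a : Fin n →₀ ℕ, φ (genVermaTmul p (pbwMonomial (fun i => (u i : g)) a)) =
        MvPolynomial.monomial a 1) ∧
      (∃ Φ : UniversalEnvelopingAlgebra K g →ₗ[K] WeylAlgebra K n, DiagramCommutes φ Φ) ∧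
      ∀ Φ : UniversalEnvelopingAlgebra K g →ₗ[K] WeylAlgebra K n, DiagramCommutes φ Φ →
        ∀ a c : UniversalEnvelopingAlgebra K g, Φ (a * c - c * a) = Φ a * Φ c - Φ c * Φ a := by
  obtain ⟨ht, hh⟩ := exists_isParabolicHeight hb hbp
  choose β hβ0 hβ using hu
  have hcompl : IsCompl (oppositeNilradical H p).toSubmodule p.toSubmodule :=
    hh.oppositeNilradical_eq ▸ hh.isCompl_weightSup
  have hspan : Submodule.span K (Set.range fun i => (u i : g)) =
      (oppositeNilradical H p).toSubmodule := by
    have h := congrArg (Submodule.map (oppositeNilradical H p).toSubmodule.subtype) u.span_eq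
    rw [Submodule.map_span, ← Set.range_comp, Submodule.map_top, Submodule.range_subtype] at h
    exact h
  have hβneg (i : Fin n) : ht (β i) < 0 := by
    by_contra! hi
    have hmem : (u i : g) ∈ p.toSubmodule := hh.le _ hi (hβ i)
    exact u.ne_zero i (Subtype.ext (Submodule.disjoint_def.mp hcompl.disjoint _ (u i).2 hmem))
  -- The depth of `u k` is `-ht (β k) > 0`. The bracket has weight `β i + β j`, so it is a
  -- combination of basis vectors of strictly greater depth than `u j`.
  have hbr (i j : Fin n) : ⁅(u i : g), (u j : g)⁆ ∈ Submodule.span K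
      ((fun i => (u i : g)) '' {k | (-ht (β j)).toNat < (-ht (β k)).toNat}) := by
    have hmem : ⁅(u i : g), (u j : g)⁆ ∈ Submodule.span K (Set.range fun i => (u i : g)) := by
      rw [hspan]
      exact (oppositeNilradical H p).lie_mem (u i).2 (u j).2
    have hroot : ⁅(u i : g), (u j : g)⁆ ∈ rootSpace H ((β i : H → K) + β j) :=
      lie_mem_genWeightSpace_of_mem_genWeightSpace (hβ i) (hβ j)
    by_cases hne : rootSpace H ((β i : H → K) + β j) = ⊥
    · rw [hne, LieSubmodule.mem_bot] at hroot
      rw [hroot]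
      exact zero_mem _
    · refine Submodule.span_mono (Set.image_mono fun k hk => ?_)
        (mem_span_of_mem_rootSpace (γ := ⟨_, hne⟩) hβ hroot hmem)
      have hk' : β k = ⟨_, hne⟩ := hk
      have := hh.add (β i) (β j) (β k) (by rw [hk']; rfl)
      have h1 := hβneg i
      have h2 := hβneg j
      change (-ht (β j)).toNat < (-ht (β k)).toNat
      omega
  let q := Module.finBasis K p
  let e : Module.Basis (Fin n ⊕ Fin (Module.finrank K p)) K g :=
    (u.prod q).map (Submodule.prodEquivOfIsCompl _ _ hcompl)
  have he_inl (i : Fin n) : e (Sum.inl i) = (u i : g) := by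
    have h : u.prod q (Sum.inl i) = (u i, 0) := by simp
    change ((u.prod q (Sum.inl i)).1 : g) + ((u.prod q (Sum.inl i)).2 : g) = _
    rw [h]
    exact add_zero _
  have he_inr (j : Fin (Module.finrank K p)) : e (Sum.inr j) = (q j : g) := by
    have h : u.prod q (Sum.inr j) = (0, q j) := by simp
    change ((u.prod q (Sum.inr j)).1 : g) + ((u.prod q (Sum.inr j)).2 : g) = _
    rw [h]
    exact zero_add _
  obtain ⟨φ, hφ⟩ := exists_genVerma_equiv (u := fun i => (u i : g))
    (ad_injective_of_isSemisimple K g) q e he_inl he_inr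
  refine ⟨φ, hφ, exists_diagramCommutes (conj_lsmul_mem hφ (fun i => ?_) hbr ?_),
    fun Φ hΦ => hΦ.map_commutator⟩
  · exact LieAlgebra.isNilpotent_ad_of_mem_rootSpace H (hβ0 i) (hβ i)
  · rw [hspan]
    exact hcompl.sup_eq_top
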